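/- Let $g,\lambda,\alpha,\beta,R,P>0$, let $\mathbb T$ be the one-dimensional torus of length $|\mathbb T|>0$, and consider for $0<\varepsilon\le 1$ the system $$\begin{aligned} i\partial_t\psi&=-\tfrac12\partial_x^2\psi+g|\psi|^2\psi+\lambda n\psi+\tfrac i2(Rn-\alpha)\psi,\\ \varepsilon\partial_t n&=P-(R|\psi|^2+\beta)n,\end{aligned}\qquad x\in\mathbb T,$$ with $\psi$ complex-valued and $n$ real-valued. For a solution with $n>0$ put $$E(t)=\int_{\mathbb T}\Big(\tfrac12|\partial_x\psi|^2+\tfrac g2|\psi|^4+\lambda n|\psi|^2\Big)dx,$$ $$F(t)=E(t)+\frac{\varepsilon}{2}\int_{\mathbb T}(\partial_x\sqrt n)^2dx-\frac{\lambda P}{R}\int_{\mathbb T}\ln n\,dx+\frac{\beta\lambda}{R}\int_{\mathbb T}n\,dx.$$ For every $N\in\mathbb R$ there are constants $C_1>0$ and $C_2\ge 0$, depending only on $g,\lambda,\alpha,\beta,R,P,|\mathbb T|$ and $N$ (in particular not on $\varepsilon$), such that the following holds. Let $0<\varepsilon\le1$, let $T_{\max}\in(0,\infty]$, and let $(\psi,n)\in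 C([0,T_{\max});H^1(\mathbb T)\oplus H^1(\mathbb T))$ be a solution of the system, in the sense of distributions on $\mathbb T$ for every $t\in[0,T_{\max})$, such that $n(t,x)>0$ for all $t\in[0,T_{\max})$ and $x\in\mathbb T$, and $n(0,x)\le N$ for all $x\in\mathbb T$. Then, for all $t\in[0,T_{\max})$, $\sqrt{n(t,\cdot)}\in H^1(\mathbb T)$, all the integrals in $F(t)$ converge, and $$F(t)\le e^{C_1t}\Big(F(0)+\frac{C_2}{C_1}\Big)-\frac{C_2}{C_1}<\infty .$$ -/

import Mathlib

open MeasureTheory Set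
open scoped ContDiff ENNReal

noncomputable section

namespace GrossPitaevskii

variable {L : ℝ} [Fact (0 < L)] {𝕜 : Type*} [RCLike 𝕜]

/-! The torus of length `L` is `AddCircle L`; its Lebesgue measure `volume` has total mass `L`. -/

/-- A function on the torus is smooth if the periodic function on the line it induces is. -/
def TorusSmooth (φ : AddCircle L → 𝕜) : Prop :=
  ContDiff ℝ ∞ (fun s : ℝ => φ (s : AddCircle L))

/-- The classical derivative of a function on the torus. -/
def torusDeriv (φ : AddCircle L → 𝕜) (x : AddCircle L) : 𝕜 :=
  deriv (fun s : ℝ => φ (x + (s : AddCircle L))) 0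

/-- `v` is the weak (distributional) derivative of `f` on the torus. It is only used for `f` and
`v` square integrable, so that both integrals converge. -/
def IsWeakDeriv (f v : AddCircle L → 𝕜) : Prop :=
  ∀ φ : AddCircle L → 𝕜, TorusSmooth φ →
    ∫ x, f x * torusDeriv φ x = -∫ x, v x * φ x

/-- `f` belongs to the Sobolev space `H¹` of the torus. -/
def MemH1 (f : AddCircle L → 𝕜) : Prop :=
  MemLp f 2 volume ∧ ∃ v : AddCircle L → 𝕜, MemLp v 2 volume ∧ IsWeakDeriv f v

open Classical in
/-- A weak derivative in `L²` (unique up to null sets), set to `0` if there is none. -/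
def weakDeriv (f : AddCircle L → 𝕜) : AddCircle L → 𝕜 :=
  if h : ∃ v : AddCircle L → 𝕜, MemLp v 2 volume ∧ IsWeakDeriv f v then h.choose else 0

variable (L 𝕜) in
/-- The Sobolev space `H¹` of the torus with values in `𝕜`, as the set of pairs `(f, ∂ₓ f)` in
`L² × L²`, with the topology of `L² × L²`, which is the one given by the `H¹` norm. -/
abbrev H1 : Type _ :=
  {q : Lp 𝕜 2 (volume : Measure (AddCircle L)) × Lp 𝕜 2 (volume : Measure (AddCircle L)) //
    IsWeakDeriv (q.1 : AddCircle L → 𝕜) (q.2 : AddCircle L → 𝕜)}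

/-- The function underlying an element of `H¹` (an almost everywhere class). -/
def H1.fn (u : H1 L 𝕜) : AddCircle L → 𝕜 := (u.1.1 : AddCircle L → 𝕜)

/-- The weak derivative `∂ₓ u` of an element of `H¹`. -/
def H1.dx (u : H1 L 𝕜) : AddCircle L → 𝕜 := (u.1.2 : AddCircle L → 𝕜)

/-- `m(x) > 0` at every point of the torus, where `m ∈ H¹` is identified with its continuous
representative. -/
def H1.Pos (m : H1 L ℝ) : Prop :=
  ∃ c : C(AddCircle L, ℝ), m.fn =ᵐ[volume] c ∧ ∀ x, 0 < c x

/-- The physical parameters of the model other than `ε`. -/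
structure Params where
  g : ℝ
  lam : ℝ
  α : ℝ
  β : ℝ
  R : ℝ
  P : ℝ
  g_pos : 0 < g
  lam_pos : 0 < lam
  α_pos : 0 < α
  β_pos : 0 < β
  R_pos : 0 < R
  P_pos : 0 < P

/-- The time interval `[0, T)`, where `T` may be `+∞`. -/
def timeInterval (T : EReal) : Set ℝ := {t : ℝ | 0 ≤ t ∧ (t : EReal) < T}

/-- `(ψ, n) ∈ C([0, T); H¹ ⊕ H¹)` solves
`i ∂ₜψ = -½ ∂ₓ²ψ + g|ψ|²ψ + λnψ + (i/2)(Rn - α)ψ`, `ε ∂ₜn = P - (R|ψ|² + β)n`,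
both equations being read in the sense of distributions on the torus, for every `t ∈ [0, T)`. -/
structure IsSolution (p : Params) (ε : ℝ) (T : EReal) (ψ : ℝ → H1 L ℂ) (n : ℝ → H1 L ℝ) :
    Prop where
  continuousOn_psi : ContinuousOn ψ (timeInterval T)
  continuousOn_n : ContinuousOn n (timeInterval T)
  eq_psi : ∀ φ : AddCircle L → ℂ, TorusSmooth φ → ∀ t ∈ timeInterval T,
    HasDerivWithinAt (fun s : ℝ => Complex.I * ∫ x, (ψ s).fn x * φ x)
      (∫ x, ((1 / 2 : ℂ) * ((ψ t).dx x * torusDeriv φ x)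
        + ((p.g : ℂ) * (‖(ψ t).fn x‖ : ℂ) ^ 2 * (ψ t).fn x
          + (p.lam : ℂ) * ((n t).fn x : ℂ) * (ψ t).fn x
          + Complex.I / 2 * ((p.R : ℂ) * ((n t).fn x : ℂ) - (p.α : ℂ)) * (ψ t).fn x) * φ x))
      (timeInterval T) t
  eq_n : ∀ φ : AddCircle L → ℝ, TorusSmooth φ → ∀ t ∈ timeInterval T,
    HasDerivWithinAt (fun s : ℝ => ε * ∫ x, (n s).fn x * φ x)
      (∫ x, (p.P - (p.R * ‖(ψ t).fn x‖ ^ 2 + p.β) * (n t).fn x) * φ x)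
      (timeInterval T) t

/-- The energy density `½|∂ₓψ|² + (g/2)|ψ|⁴ + λ n|ψ|²`. -/
def energyDensity (p : Params) (u : H1 L ℂ) (m : H1 L ℝ) (x : AddCircle L) : ℝ :=
  1 / 2 * ‖u.dx x‖ ^ 2 + p.g / 2 * ‖u.fn x‖ ^ 4 + p.lam * m.fn x * ‖u.fn x‖ ^ 2

/-- The energy `E`. -/
def energy (p : Params) (u : H1 L ℂ) (m : H1 L ℝ) : ℝ :=
  ∫ x, energyDensity p u m x

/-- The functional `F = E + (ε/2) ∫ (∂ₓ√n)² - (λP/R) ∫ ln n + (βλ/R) ∫ n`. -/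
def functionalF (p : Params) (ε : ℝ) (u : H1 L ℂ) (m : H1 L ℝ) : ℝ :=
  energy p u m + ε / 2 * (∫ x, (weakDeriv (fun y => √(m.fn y)) x) ^ 2)
    - p.lam * p.P / p.R * (∫ x, Real.log (m.fn x))
    + p.β * p.lam / p.R * (∫ x, m.fn x)

/-- All the integrals in the functional `F` are defined and finite, i.e. `F < ∞`. -/
structure FiniteF (p : Params) (u : H1 L ℂ) (m : H1 L ℝ) : Prop where
  energy_integrable : Integrable (energyDensity p u m) volume
  sqrt_memH1 : MemH1 (fun y => √(m.fn y))
  log_integrable : Integrable (fun x => Real.log (m.fn x)) volume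
  n_integrable : Integrable m.fn volume

end GrossPitaevskii

end

/-!
The functional `F` grows at most exponentially because the only terms in `dF/dt` without a
favourable sign come from the gain `½(Rn - α)ψ`, and these are at most `2 R (sup n)` times the
energy.

Write `m = Rn - α` and `a = R|ψ|² + β`. The Hamiltonian part of the flow
conserves the energy for frozen `n`, the gain contributes
`∫ m (½|∂ₓψ|² + λn|ψ|² + g|ψ|⁴) + (R/2) ∫ ∂ₓn Re(ψ̄ ∂ₓψ)`, and the motion of `n` contributes
`λ ∫ ∂ₜn |ψ|²`. The last term combines with the derivatives of the logarithm and of `∫ n` to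
`-(λ/(Rε)) ∫ (P - an)²/n ≤ 0`. For `w = √n` one has `ε ∂ₜw = ½(P/w - aw)`, so `(ε/2) ∫ (∂ₓw)²` has
derivative `-½ ∫ (P/n + a)(∂ₓw)² - R ∫ w ∂ₓw Re(ψ̄ ∂ₓψ)`, and since `∂ₓn = 2w ∂ₓw` its second term
cancels the one of indefinite sign above. This is the pointwise inequality `dissipation_le`.
Comparison with `ε ∂ₜn ≤ P - βn` gives `n ≤ M = max N (P/β)` (`n_le`), and the energy is at most
`F` plus a constant, because `∫ ln n ≤ L max (ln M) 0` (`energy_le_pairF`). Gronwall's inequality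
finishes the proof.

The computation is formal, since `ψ` has only one derivative in `x` and `∂ₜψ` is a distribution.
It is made rigorous as follows. `H¹` is realised as the closure `sobolevPairs` of the smooth pairs
`(u, ∂ₓu)` in `C × L²`, where products (`mul_mem_sobolevPairs`) and the chain rule
(`chain_mem_sobolevPairs`) pass to the limit; Fourier series and the Sobolev inequality show that
every weakly differentiable function belongs to it (`exists_mem_sobolevPairs_complex`).

* A curve whose derivative exists when tested with a separating family of functionals, and is
  norm continuous, is norm differentiable (`hasDerivAt_of_functionals`). This makes `n`, `√n` and
  `ln n` differentiable in time with values in `C`, and `∂ₓ√n` with values in `L²`.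
* The kinetic energy is differentiated mode by mode in the Fourier basis, where the Laplacian is
  skew (`hasDerivAt_norm_sq_of_skew`, `hasDerivAt_kinetic`).
* The increment of the interaction energy `∫ (λn|ψ|² + (g/2)|ψ|⁴)` between the times `t` and `s` is
  `⟨ψ(s) - ψ(t), q(s)⟩` plus the part due to `n`, with `q` continuous in time with values in `H¹`;
  the difference `ψ(s) - ψ(t)`, an integral in time of a functional on `H¹`, may be
  tested against it (`hasDerivAt_inner_increment`, `hasDerivAt_interactionEnergy`).
-/

noncomputable section

namespace GrossPitaevskii

open Filter Topology

variable {L : ℝ} [hL : Fact (0 < L)]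
variable {E F G : Type*} [NormedAddCommGroup E] [NormedSpace ℝ E]
  [NormedAddCommGroup F] [NormedSpace ℝ F] [NormedAddCommGroup G] [NormedSpace ℝ G]
variable {𝕜 : Type*} [RCLike 𝕜]

/-! ### The Sobolev space of the torus -/

/-- The square integrable functions on the torus of length `L`. -/
abbrev L2 (L : ℝ) [Fact (0 < L)] (E : Type*) [NormedAddCommGroup E] : Type _ :=
  Lp E 2 (volume : Measure (AddCircle L))

/-- A continuous function together with a candidate for its derivative in `L²`. -/
abbrev Pair (L : ℝ) [Fact (0 < L)] (E : Type*) [NormedAddCommGroup E] [NormedSpace ℝ E] : Type _ :=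
  C(AddCircle L, E) × L2 L E

/-- The inclusion of the continuous functions into `L²`. -/
def toL2 : C(AddCircle L, E) →L[ℝ] L2 L E := ContinuousMap.toLp 2 volume ℝ

lemma coeFn_toL2 (u : C(AddCircle L, E)) : (toL2 u : AddCircle L → E) =ᵐ[volume] u :=
  ContinuousMap.coeFn_toLp volume u

lemma toL2_injective : Function.Injective (toL2 (L := L) (E := E)) :=
  ContinuousMap.toLp_injective (𝕜 := ℝ) volume

/-- Pointwise product, along a bilinear map `B`, of a continuous and an `L²` function. -/
def mulL2 (B : E →L[ℝ] F →L[ℝ] G) : C(AddCircle L, E) →L[ℝ] L2 L F →L[ℝ] L2 L G :=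
  (B.holderL volume ∞ 2 2).comp (ContinuousMap.toLp ∞ volume ℝ)

lemma coeFn_mulL2 (B : E →L[ℝ] F →L[ℝ] G) (u : C(AddCircle L, E)) (v : L2 L F) :
    (mulL2 B u v : AddCircle L → G) =ᵐ[volume] fun x => B (u x) (v x) := by
  have h : mulL2 B u v = B.holder 2 (ContinuousMap.toLp ∞ volume ℝ u) v := rfl
  rw [h]
  filter_upwards [B.coeFn_holder (r := 2) (ContinuousMap.toLp ∞ volume ℝ u) v,
    ContinuousMap.coeFn_toLp (p := ∞) (𝕜 := ℝ) volume u] with x h1 h2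
  rw [h1, h2]

/-- Pointwise product, along a bilinear map `B`, of continuous functions. -/
def mulC (B : E →L[ℝ] F →L[ℝ] G) (u : C(AddCircle L, E)) (w : C(AddCircle L, F)) :
    C(AddCircle L, G) :=
  ⟨fun x => B (u x) (w x), by fun_prop⟩

omit hL in
@[simp] lemma mulC_apply (B : E →L[ℝ] F →L[ℝ] G) (u : C(AddCircle L, E))
    (w : C(AddCircle L, F)) (x : AddCircle L) : mulC B u w x = B (u x) (w x) := rfl

omit hL in
lemma continuous_mulC (B : E →L[ℝ] F →L[ℝ] G) :
    Continuous fun q : C(AddCircle L, E) × C(AddCircle L, F) => mulC B q.1 q.2 := by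
  refine ContinuousMap.continuous_of_continuous_uncurry _ ?_
  change Continuous fun z : (C(AddCircle L, E) × C(AddCircle L, F)) × AddCircle L =>
    B (z.1.1 z.2) (z.1.2 z.2)
  fun_prop

lemma mulL2_toL2 (B : E →L[ℝ] F →L[ℝ] G) (u : C(AddCircle L, E)) (w : C(AddCircle L, F)) :
    mulL2 B u (toL2 w) = toL2 (mulC B u w) := by
  apply Lp.ext
  filter_upwards [coeFn_mulL2 B u (toL2 w), coeFn_toL2 w, coeFn_toL2 (mulC B u w)]
    with x h1 h2 h3
  rw [h1, h2, h3, mulC_apply]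

lemma continuous_mulL2 (B : E →L[ℝ] F →L[ℝ] G) :
    Continuous fun q : C(AddCircle L, E) × L2 L F => mulL2 B q.1 q.2 := by fun_prop

/-- The integral over the torus as a continuous functional on `L²`. -/
def intL2 [CompleteSpace G] : L2 L G →L[ℝ] G :=
  (ContinuousLinearMap.lsmul ℝ ℝ : ℝ →L[ℝ] G →L[ℝ] G).lpPairing volume 2 2 (toL2 1)

lemma intL2_apply [CompleteSpace G] (v : L2 L G) : intL2 v = ∫ x, v x := by
  rw [intL2, ContinuousLinearMap.lpPairing_eq_integral]
  refine integral_congr_ae ?_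
  filter_upwards [coeFn_toL2 (L := L) (1 : C(AddCircle L, ℝ))] with x hx
  simp [hx]

variable (L E) in
/-- The smooth functions on the torus, paired with their derivatives. -/
def smoothPairs : Submodule ℝ (Pair L E) where
  carrier := {q | ∃ d : C(AddCircle L, E), ContDiff ℝ ∞ (fun s : ℝ => q.1 s) ∧
    (∀ s : ℝ, HasDerivAt (fun s : ℝ => q.1 s) (d s) s) ∧ q.2 = toL2 d}
  add_mem' := by
    rintro a b ⟨d, h1, h2, h3⟩ ⟨e, h4, h5, h6⟩
    exact ⟨d + e, h1.add h4, fun s => (h2 s).add (h5 s), by simp [h3, h6]⟩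
  zero_mem' := ⟨0, contDiff_const, fun s => hasDerivAt_const _ _, by simp⟩
  smul_mem' := by
    rintro c a ⟨d, h1, h2, h3⟩
    exact ⟨c • d, h1.const_smul c, fun s => (h2 s).const_smul c, by simp [h3]⟩

variable (L E) in
/-- The Sobolev space `H¹` of the torus as a space of pairs `(u, ∂ₓu)` with `u` continuous and
`∂ₓu` square integrable: the closure of the smooth pairs in `C × L²`. -/
def sobolevPairs : Submodule ℝ (Pair L E) :=
  (smoothPairs L E).topologicalClosure

lemma isClosed_sobolevPairs : IsClosed (sobolevPairs L E : Set (Pair L E)) :=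
  Submodule.isClosed_topologicalClosure _

lemma smoothPairs_le : smoothPairs L E ≤ sobolevPairs L E :=
  Submodule.le_topologicalClosure _

/-- To prove a closed condition on `H¹` it is enough to prove it for smooth functions. -/
lemma sobolevPairs_induction {P : Pair L E → Prop}
    (hP : IsClosed {q | P q}) (h : ∀ q ∈ smoothPairs L E, P q) {q : Pair L E}
    (hq : q ∈ sobolevPairs L E) : P q :=
  closure_minimal (s := (smoothPairs L E : Set (Pair L E))) (t := {q | P q})
    (fun q hq => h q hq) hP hq

lemma const_mem_sobolevPairs (c : E) : ((ContinuousMap.const _ c, 0) :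
    Pair L E) ∈ sobolevPairs L E :=
  smoothPairs_le ⟨0, contDiff_const, fun s => hasDerivAt_const _ _, by simp⟩

/-- The Leibniz rule in `H¹`. -/
lemma mul_mem_sobolevPairs (B : E →L[ℝ] F →L[ℝ] G) {q : Pair L E}
    {r : Pair L F} (hq : q ∈ sobolevPairs L E) (hr : r ∈ sobolevPairs L F) :
    ((mulC B q.1 r.1, mulL2 B q.1 r.2 + mulL2 B.flip r.1 q.2) :
      Pair L G) ∈ sobolevPairs L G := by
  have hcont : Continuous fun z : Pair L E × Pair L F =>
      ((mulC B z.1.1 z.2.1, mulL2 B z.1.1 z.2.2 + mulL2 B.flip z.2.1 z.1.2) :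
      Pair L G) := by
    refine Continuous.prodMk ((continuous_mulC B).comp
      (f := fun z : Pair L E × Pair L F => (z.1.1, z.2.1)) (by fun_prop)) ?_
    exact ((continuous_mulL2 B).comp
      (f := fun z : Pair L E × Pair L F => (z.1.1, z.2.2)) (by fun_prop)).add
      ((continuous_mulL2 B.flip).comp
        (f := fun z : Pair L E × Pair L F => (z.2.1, z.1.2)) (by fun_prop))
  refine map_mem_closure₂ (f := fun (q : Pair L E)
    (r : Pair L F) => ((mulC B q.1 r.1, mulL2 B q.1 r.2 + mulL2 B.flip r.1 q.2) :
      Pair L G)) hcont hq hr ?_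
  rintro a ⟨d, h1, h2, h3⟩ b ⟨e, h4, h5, h6⟩
  refine ⟨mulC B a.1 e + mulC B.flip b.1 d, ?_, fun s => ?_, ?_⟩
  · exact B.isBoundedBilinearMap.contDiff.comp (h1.prodMk h4)
  · have := B.hasFDerivAt_of_bilinear (h2 s).hasFDerivAt (h5 s).hasFDerivAt
    convert! this.hasDerivAt using 1
    simp
  · simp [h3, h6, mulL2_toL2]

lemma comp_mem_smoothPairs (A : E →L[ℝ] F) {q : Pair L E}
    (hq : q ∈ smoothPairs L E) :
    ((A.compLeftContinuous ℝ (AddCircle L) q.1, A.compLpL 2 volume q.2) :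
      Pair L F) ∈ smoothPairs L F := by
  obtain ⟨d, h1, h2, h3⟩ := hq
  refine ⟨A.compLeftContinuous ℝ _ d, A.contDiff.comp h1,
    fun s => A.hasFDerivAt.comp_hasDerivAt s (h2 s), ?_⟩
  apply Lp.ext
  simp only [h3]
  filter_upwards [A.coeFn_compLpL (toL2 d), coeFn_toL2 d,
    coeFn_toL2 (A.compLeftContinuous ℝ _ d)] with x h4 h5 h6
  rw [h4, h5, h6]; rfl

/-- Composition with a continuous linear map acts on `H¹`. -/
lemma comp_mem_sobolevPairs (A : E →L[ℝ] F) {q : Pair L E}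
    (hq : q ∈ sobolevPairs L E) :
    ((A.compLeftContinuous ℝ (AddCircle L) q.1, A.compLpL 2 volume q.2) :
      Pair L F) ∈ sobolevPairs L F := by
  have hcont : Continuous fun q : Pair L E =>
    ((A.compLeftContinuous ℝ (AddCircle L) q.1, A.compLpL 2 volume q.2) :
      Pair L F) := by fun_prop
  exact map_mem_closure (s := (smoothPairs L E : Set (Pair L E)))
    (t := (smoothPairs L F : Set (Pair L F)))
    (f := fun q => (A.compLeftContinuous ℝ (AddCircle L) q.1, A.compLpL 2 volume q.2)) hcont hq
    fun a ha => comp_mem_smoothPairs A ha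

lemma integral_eq_intervalIntegral (f : AddCircle L → G) (a : ℝ) :
    ∫ x, f x = ∫ s in a..(a + L), f s :=
  (AddCircle.intervalIntegral_preimage L a f).symm

/-- The derivative of a periodic function has integral zero. -/
lemma integral_deriv_eq_zero [CompleteSpace E] {q : Pair L E}
    (hq : q ∈ sobolevPairs L E) : ∫ x, q.2 x = 0 := by
  rw [← intL2_apply]
  refine sobolevPairs_induction (P := fun q => intL2 q.2 = 0)
    (isClosed_eq (by fun_prop) continuous_const) ?_ hq
  rintro a ⟨d, h1, h2, h3⟩
  rw [intL2_apply, h3, integral_congr_ae (coeFn_toL2 d), integral_eq_intervalIntegral _ 0]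
  have hc : Continuous fun s : ℝ => d s := d.continuous.comp (AddCircle.continuous_mk' L)
  rw [intervalIntegral.integral_eq_sub_of_hasDerivAt (fun s _ => h2 s) (hc.intervalIntegrable _ _)]
  simp [AddCircle.coe_period]

lemma norm_toL2_norm (u : C(AddCircle L, E)) :
    ‖toL2 (⟨fun x => ‖u x‖, by fun_prop⟩ : C(AddCircle L, ℝ))‖ = ‖toL2 u‖ := by
  rw [Lp.norm_def, Lp.norm_def, eLpNorm_congr_ae (coeFn_toL2 _), eLpNorm_congr_ae (coeFn_toL2 u)]
  congr 1
  exact eLpNorm_norm _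

lemma integral_norm_le (u : C(AddCircle L, E)) :
    ∫ x, ‖u x‖ ≤ ‖intL2 (L := L) (G := ℝ)‖ * ‖toL2 u‖ := by
  have h := (intL2 (L := L) (G := ℝ)).le_opNorm (toL2 ⟨fun x => ‖u x‖, by fun_prop⟩)
  rw [norm_toL2_norm, intL2_apply, integral_congr_ae (coeFn_toL2 _)] at h
  exact (Real.le_norm_self _).trans h

variable (L) in
/-- The constant in the Sobolev inequality. -/
def sobolevConst : ℝ := ‖intL2 (L := L) (G := ℝ)‖ * (1 + L⁻¹)

/-- The Sobolev embedding of `H¹` into the continuous functions. -/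
lemma norm_le_of_mem_sobolevPairs [CompleteSpace E] {q : Pair L E}
    (hq : q ∈ sobolevPairs L E) : ‖q.1‖ ≤ sobolevConst L * (‖toL2 q.1‖ + ‖q.2‖) := by
  have hL0 := hL.out
  refine sobolevPairs_induction (P := fun q => ‖q.1‖ ≤ sobolevConst L * (‖toL2 q.1‖ + ‖q.2‖))
    (isClosed_le (by fun_prop) (by fun_prop)) ?_ hq
  rintro a ⟨d, h1, h2, h3⟩
  have hc : Continuous fun s : ℝ => d s := d.continuous.comp (AddCircle.continuous_mk' L)
  set K := ‖intL2 (L := L) (G := ℝ)‖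
  have hK : 0 ≤ K := norm_nonneg _
  -- The oscillation is at most the `L¹` norm of the derivative; averaging over `y` bounds `‖u‖`.
  have hosc : ∀ x y, ‖a.1 x‖ ≤ ‖a.1 y‖ + K * ‖a.2‖ := by
    intro x y
    obtain ⟨s, rfl⟩ := QuotientAddGroup.mk_surjective y
    obtain ⟨t, ht, rfl⟩ : ∃ t ∈ Ico s (s + L), (t : AddCircle L) = x := by
      have := AddCircle.coe_image_Ico_eq L s
      exact (this ▸ mem_univ x : x ∈ _)
    have hft := intervalIntegral.integral_eq_sub_of_hasDerivAt (a := s) (b := t)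
      (fun s _ => h2 s) (hc.intervalIntegrable _ _)
    have h5 : ‖a.1 t - a.1 s‖ ≤ K * ‖a.2‖ := by
      rw [← hft, h3]
      refine le_trans ?_ (integral_norm_le d)
      rw [integral_eq_intervalIntegral _ s]
      refine (intervalIntegral.norm_integral_le_integral_norm ht.1).trans ?_
      refine intervalIntegral.integral_mono_interval le_rfl ht.1 ht.2.le ?_
        (hc.norm.intervalIntegrable _ _)
      exact Eventually.of_forall fun _ => norm_nonneg _
    have := norm_le_insert' (a.1 t) (a.1 s)
    linarith! [this]
  rw [ContinuousMap.norm_le _ (by unfold sobolevConst; positivity)]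
  intro x
  have h6 : ∫ _ : AddCircle L, ‖a.1 x‖ ≤ ∫ y, (‖a.1 y‖ + K * ‖a.2‖) := by
    refine integral_mono (integrable_const _) ?_ (fun y => hosc x y)
    exact (Continuous.integrable_of_hasCompactSupport (by fun_prop)
      (HasCompactSupport.of_compactSpace _))
  rw [integral_add (Continuous.integrable_of_hasCompactSupport (by fun_prop)
      (HasCompactSupport.of_compactSpace _)) (integrable_const _)] at h6
  simp only [integral_const, Measure.real, AddCircle.measure_univ, smul_eq_mul,
    ENNReal.toReal_ofReal hL0.le] at h6
  have h7 := integral_norm_le a.1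
  have h8 : L * ‖a.1 x‖ ≤ K * ‖toL2 a.1‖ + L * (K * ‖a.2‖) := by linarith!
  have h9 : ‖a.1 x‖ ≤ L⁻¹ * (K * ‖toL2 a.1‖) + K * ‖a.2‖ := by
    have := mul_le_mul_of_nonneg_left h8 (inv_nonneg.2 hL0.le)
    rw [← mul_assoc, inv_mul_cancel₀ hL0.ne', mul_add, ← mul_assoc L⁻¹ L,
      inv_mul_cancel₀ hL0.ne'] at this
    linarith
  have h10 : 0 ≤ K * ‖toL2 a.1‖ := by positivity
  have h11 : 0 ≤ L⁻¹ * (K * ‖a.2‖) := by positivity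
  unfold sobolevConst
  calc _ ≤ _ := h9
    _ ≤ _ := by change _ ≤ K * (1 + L⁻¹) * _; linarith

/-! ### Weak derivatives and Fourier series -/

/-- Integration by parts in `H¹`. -/
lemma integral_by_parts [CompleteSpace G] (B : E →L[ℝ] F →L[ℝ] G)
    {q : Pair L E} {r : Pair L F}
    (hq : q ∈ sobolevPairs L E) (hr : r ∈ sobolevPairs L F) :
    ∫ x, B (q.1 x) (r.2 x) = -∫ x, B (q.2 x) (r.1 x) := by
  have h := integral_deriv_eq_zero (mul_mem_sobolevPairs B hq hr)
  rw [← intL2_apply, map_add, intL2_apply, intL2_apply, integral_congr_ae (coeFn_mulL2 _ _ _),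
    integral_congr_ae (coeFn_mulL2 _ _ _)] at h
  exact eq_neg_of_add_eq_zero_left h

omit hL in
lemma torusDeriv_eq {φ d : AddCircle L → 𝕜}
    (h : ∀ s : ℝ, HasDerivAt (fun s : ℝ => φ s) (d s) s) (x : AddCircle L) :
    torusDeriv φ x = d x := by
  obtain ⟨s, rfl⟩ := QuotientAddGroup.mk_surjective x
  have h1 : HasDerivAt (fun r : ℝ => φ ((s + r : ℝ) : AddCircle L)) (d s) 0 :=
    HasDerivAt.comp_const_add s 0 (by simpa using h s)
  exact h1.deriv

/-- A smooth function on the torus and its classical derivative form a smooth pair. -/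
lemma TorusSmooth.exists_pair {φ : AddCircle L → 𝕜} (hφ : TorusSmooth φ) :
    ∃ u d : C(AddCircle L, 𝕜), ⇑u = φ ∧ ⇑d = torusDeriv φ ∧ (u, toL2 d) ∈ smoothPairs L 𝕜 := by
  have hq : Topology.IsQuotientMap ((↑) : ℝ → AddCircle L) := isQuotientMap_quotient_mk'
  have hper : ∀ s : ℝ, deriv (fun s : ℝ => φ s) s = torusDeriv φ s := by
    intro s
    rw [torusDeriv]
    have := deriv_comp_const_add (f := fun s : ℝ => φ s) s 0
    simp only [add_zero] at this
    rw [← this]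
    simp
  have hd : ∀ s : ℝ, HasDerivAt (fun s : ℝ => φ s) (torusDeriv φ s) s := by
    intro s
    rw [← hper]
    exact (hφ.differentiable (by simp) s).hasDerivAt
  have hc : Continuous (torusDeriv φ) := by
    rw [hq.continuous_iff]
    have := hφ.continuous_deriv (by simp)
    exact this.congr hper
  have hc0 : Continuous φ := by
    rw [hq.continuous_iff]
    exact hφ.continuous
  exact ⟨⟨φ, hc0⟩, ⟨_, hc⟩, rfl, rfl, ⟨_, hc⟩, hφ, hd, rfl⟩

/-- The elements of `H¹` satisfy the weak formulation. -/
lemma isWeakDeriv_of_mem_sobolevPairs {q : Pair L 𝕜}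
    (hq : q ∈ sobolevPairs L 𝕜) {f v : AddCircle L → 𝕜} (hf : f =ᵐ[volume] q.1)
    (hv : v =ᵐ[volume] q.2) : IsWeakDeriv f v := by
  intro φ hφ
  obtain ⟨u, d, rfl, hd, hs⟩ := hφ.exists_pair
  have h := integral_by_parts (ContinuousLinearMap.mul ℝ 𝕜) hq (smoothPairs_le hs)
  rw [← hd]
  convert h using 1
  · refine integral_congr_ae ?_
    filter_upwards [hf, coeFn_toL2 d] with x h1 h2
    simp [h1, h2]
  · congr 1
    refine integral_congr_ae ?_
    filter_upwards [hv] with x h1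
    simp [h1]

/-- The normalised exponentials on the torus of length `L`. -/
def expC (L : ℝ) [Fact (0 < L)] (k : ℤ) : C(AddCircle L, ℂ) := ((√L : ℝ) : ℂ)⁻¹ • fourier k

/-- The frequency `2πik/L` of the `k`-th exponential. -/
def freq (L : ℝ) (k : ℤ) : ℂ := 2 * Real.pi * Complex.I * k / L

lemma hasDerivAt_expC (k : ℤ) (s : ℝ) :
    HasDerivAt (fun s : ℝ => expC L k s) (freq L k * expC L k s) s := by
  convert! (hasDerivAt_fourier L k s).const_smul ((√L : ℝ) : ℂ)⁻¹ using 1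
  simp only [expC, freq, ContinuousMap.smul_apply, smul_eq_mul]
  ring

lemma contDiff_expC (k : ℤ) : ContDiff ℝ ∞ (fun s : ℝ => expC L k s) := by
  have : (fun s : ℝ => expC L k s) =
      fun s : ℝ => ((√L : ℝ) : ℂ)⁻¹ * Complex.exp (2 * Real.pi * Complex.I * k * s / L) := by
    ext s
    simp [expC]
  rw [this]
  have h2 : ContDiff ℝ ∞ (fun s : ℝ => (s : ℂ)) := Complex.ofRealCLM.contDiff
  fun_prop

lemma inner_toL2_left (u : C(AddCircle L, ℂ)) (v : L2 L ℂ) :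
    inner ℂ (toL2 u) v = ∫ x, v x * star (u x) := by
  rw [L2.inner_def]
  refine integral_congr_ae ?_
  filter_upwards [coeFn_toL2 u] with x hx
  simp [hx]

lemma orthonormal_expC : Orthonormal ℂ (fun k => toL2 (expC L k)) := by
  have hL0 := hL.out
  have h0 := orthonormal_fourier (T := L)
  rw [orthonormal_iff_ite] at h0 ⊢
  intro i j
  have h3 : ∫ x, toL2 (expC L j) x * star (expC L i x) = ∫ x, expC L j x * star (expC L i x) := by
    refine integral_congr_ae ?_
    filter_upwards [coeFn_toL2 (expC L j)] with x hx
    rw [hx]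
  rw [← h0 i j, ContinuousMap.inner_toLp, inner_toL2_left, h3,
    AddCircle.integral_haarAddCircle, ← integral_smul]
  congr 1
  ext x
  simp only [expC, ContinuousMap.smul_apply, smul_eq_mul, star_mul']
  have h1 : star (((√L : ℝ) : ℂ)⁻¹) = ((√L : ℝ) : ℂ)⁻¹ := by
    rw [← Complex.ofReal_inv]; exact Complex.conj_ofReal _
  have h2 : ((√L : ℝ) : ℂ)⁻¹ * ((√L : ℝ) : ℂ)⁻¹ = ((L⁻¹ : ℝ) : ℂ) := by
    rw [← Complex.ofReal_inv, ← Complex.ofReal_mul, ← mul_inv, Real.mul_self_sqrt hL0.le]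
  rw [h1, Complex.real_smul, ← h2]
  simp only [starRingEnd_apply]
  ring

/-- The exponentials form a Hilbert basis of `L²` for the Lebesgue measure. -/
def expBasis (L : ℝ) [hL : Fact (0 < L)] : HilbertBasis ℤ ℂ (L2 L ℂ) :=
  HilbertBasis.mk orthonormal_expC (by
    have hL0 := hL.out
    have hne : ((√L : ℝ) : ℂ) ≠ 0 := by
      rw [Complex.ofReal_ne_zero]; exact (Real.sqrt_pos.2 hL0).ne'
    have h := (ContinuousMap.toLp_denseRange ℂ (volume : Measure (AddCircle L)) ℂ
      (p := 2) (by simp)).topologicalClosure_map_submodule span_fourier_closure_eq_top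
    rw [Submodule.map_span] at h
    rw [← h]
    refine Submodule.topologicalClosure_mono (Submodule.span_le.2 ?_)
    rintro _ ⟨_, ⟨k, rfl⟩, rfl⟩
    have h1 : ContinuousMap.toLp 2 volume ℂ (fourier k) =
        ((√L : ℝ) : ℂ) • toL2 (expC L k) := by
      change _ = ((√L : ℝ) : ℂ) • ContinuousMap.toLp 2 volume ℂ (expC L k)
      rw [expC, map_smul, smul_smul, mul_inv_cancel₀ hne, one_smul]
    change ContinuousMap.toLp 2 volume ℂ (fourier k) ∈ _
    rw [h1]
    exact Submodule.smul_mem _ _ (Submodule.subset_span ⟨k, rfl⟩))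

lemma expBasis_apply (k : ℤ) : expBasis L k = toL2 (expC L k) := by
  rw [expBasis, HilbertBasis.coe_mk]

lemma hasSum_expC (f : L2 L ℂ) :
    HasSum (fun k => inner ℂ (toL2 (expC L k)) f • toL2 (expC L k)) f := by
  simpa only [HilbertBasis.repr_apply_apply, expBasis_apply] using (expBasis L).hasSum_repr f

omit hL in
lemma freq_star (k : ℤ) : star (freq L k) = -freq L k := by
  simp [freq]
  ring

/-- Differentiation multiplies the Fourier coefficients by the frequency. -/
lemma inner_expC_weakDeriv {f v : L2 L ℂ} (h : IsWeakDeriv (f : AddCircle L → ℂ) v) (k : ℤ) :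
    inner ℂ (toL2 (expC L k)) v = freq L k * inner ℂ (toL2 (expC L k)) f := by
  have hs : ∀ s : ℝ, HasDerivAt (fun s : ℝ => star (expC L k (s : AddCircle L)))
      (star (freq L k * expC L k s)) s := fun s => (hasDerivAt_expC k s).star
  have h1 := h (fun x => star (expC L k x))
    ((starL' ℝ : ℂ ≃L[ℝ] ℂ).contDiff.comp (contDiff_expC k))
  simp only [torusDeriv_eq (φ := fun x => star (expC L k x))
    (d := fun x => star (freq L k * expC L k x)) hs] at h1
  rw [inner_toL2_left, inner_toL2_left]
  simp only [star_mul', freq_star] at h1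
  rw [eq_comm, neg_eq_iff_eq_neg] at h1
  rw [h1, ← integral_neg, ← integral_const_mul]
  congr 1
  ext x
  ring

/-- A pair of square integrable functions, the second of which is the weak derivative of the
first, is given by an element of `H¹`: the Fourier series approximates both. -/
lemma exists_mem_sobolevPairs_complex {f v : L2 L ℂ} (h : IsWeakDeriv (f : AddCircle L → ℂ) v) :
    ∃ u : C(AddCircle L, ℂ), toL2 u = f ∧ (u, v) ∈ sobolevPairs L ℂ := by
  -- `H¹` is complete and embedded in `L² × L²` with a lower bound, so its image is closed.
  let j : sobolevPairs L ℂ →L[ℝ] L2 L ℂ × L2 L ℂ :=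
    (toL2.prodMap (ContinuousLinearMap.id ℝ _)).comp (sobolevPairs L ℂ).subtypeL
  have hjc : UniformContinuous j := j.uniformContinuous
  have hc0 : 0 ≤ sobolevConst L := by
    have := hL.out
    unfold sobolevConst; positivity
  have hj : AntilipschitzWith (⟨2 * sobolevConst L + 1, by positivity⟩) j := by
    refine AddMonoidHomClass.antilipschitz_of_bound j fun q => ?_
    have h1 := norm_le_of_mem_sobolevPairs q.2
    have h2 : ‖toL2 q.1.1‖ ≤ ‖j q‖ := norm_fst_le (j q)
    have h3 : ‖q.1.2‖ ≤ ‖j q‖ := norm_snd_le (j q)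
    change ‖q.1‖ ≤ (2 * sobolevConst L + 1) * ‖j q‖
    rw [Prod.norm_def, max_le_iff]
    constructor <;> nlinarith [norm_nonneg (j q)]
  have : CompleteSpace (sobolevPairs L ℂ) :=
    (isClosed_sobolevPairs (L := L) (E := ℂ)).completeSpace_coe
  have hcl := hj.isClosed_range hjc
  have hmem : (f, v) ∈ range j := by
    have h1 := (hasSum_expC f).prodMk (hasSum_expC v)
    refine hcl.mem_of_tendsto h1 (Eventually.of_forall fun s => ?_)
    have hk : ∀ k, (inner ℂ (toL2 (expC L k)) f • expC L k,
        toL2 (inner ℂ (toL2 (expC L k)) f • freq L k • expC L k)) ∈ sobolevPairs L ℂ := fun k =>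
      smoothPairs_le ⟨_, contDiff_const.smul (contDiff_expC k), fun s =>
        (hasDerivAt_expC k s).const_smul (inner ℂ (toL2 (expC L k)) f), rfl⟩
    have hs : ∀ (c : ℂ) (u : C(AddCircle L, ℂ)), toL2 (c • u) = c • toL2 u := fun c u =>
      map_smul (ContinuousMap.toLp 2 volume ℂ) c u
    refine ⟨∑ k ∈ s, ⟨_, hk k⟩, ?_⟩
    rw [map_sum]
    refine Finset.sum_congr rfl fun k _ => Prod.ext ?_ ?_
    · exact hs _ _
    · change toL2 (inner ℂ (toL2 (expC L k)) f • freq L k • expC L k) =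
        inner ℂ (toL2 (expC L k)) v • toL2 (expC L k)
      rw [hs, hs, smul_smul, inner_expC_weakDeriv h, mul_comm]
  obtain ⟨⟨⟨u, w⟩, hq⟩, hq2⟩ := hmem
  have h1 : toL2 u = f := congrArg Prod.fst hq2
  have h2 : w = v := congrArg Prod.snd hq2
  exact ⟨u, h1, h2 ▸ hq⟩

lemma integrable_mul_continuous (v : L2 L 𝕜) (u : C(AddCircle L, 𝕜)) :
    Integrable (fun x => v x * u x) volume := by
  refine ((L2.integrable_inner (𝕜 := 𝕜) (toL2 (star u)) v).congr ?_)
  filter_upwards [coeFn_toL2 (star u)] with x hx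
  simp [hx]

/-- A weak derivative in the class of real functions is a weak derivative in the class of complex
functions. -/
lemma isWeakDeriv_ofReal {f v : L2 L ℝ} (h : IsWeakDeriv (f : AddCircle L → ℝ) v) :
    IsWeakDeriv (Complex.ofRealCLM.compLpL 2 volume f : AddCircle L → ℂ)
      (Complex.ofRealCLM.compLpL 2 volume v) := by
  intro φ hφ
  obtain ⟨u, d, rfl, hd, e, hs, hs', he⟩ := hφ.exists_pair
  obtain rfl : d = e := toL2_injective he
  have key : ∀ A : ℂ →L[ℝ] ℝ, ∫ x, f x * A (d x) = -∫ x, v x * A (u x) := by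
    intro A
    have h1 := h (fun x => A (u x)) (A.contDiff.comp hs)
    have h2 : ∀ x, torusDeriv (fun x => A (u x)) x = A (d x) :=
      torusDeriv_eq (φ := fun x => A (u x)) (d := fun x => A (d x))
        (fun s => A.hasFDerivAt.comp_hasDerivAt s (hs' s))
    simpa only [h2] using h1
  rw [← hd]
  have aux : ∀ (g : L2 L ℝ) (w : C(AddCircle L, ℂ)),
      (∫ x, Complex.ofRealCLM.compLpL 2 volume g x * w x).re =
        ∫ x, g x * Complex.reCLM (w x) ∧
      (∫ x, Complex.ofRealCLM.compLpL 2 volume g x * w x).im =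
        ∫ x, g x * Complex.imCLM (w x) := by
    intro g w
    have hi := integrable_mul_continuous (Complex.ofRealCLM.compLpL 2 volume g) w
    have h3 := Complex.ofRealCLM.coeFn_compLpL (p := 2) (μ := volume) g
    constructor
    · refine (integral_re (𝕜 := ℂ) hi).symm.trans (integral_congr_ae ?_)
      filter_upwards [h3] with x hx
      simp [hx]
    · refine (integral_im (𝕜 := ℂ) hi).symm.trans (integral_congr_ae ?_)
      filter_upwards [h3] with x hx
      simp [hx]
  refine Complex.ext ?_ ?_
  · rw [Complex.neg_re, (aux f d).1, (aux v u).1, key]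
  · rw [Complex.neg_im, (aux f d).2, (aux v u).2, key]

/-- The real case of `exists_mem_sobolevPairs_complex`. -/
lemma exists_mem_sobolevPairs_real {f v : L2 L ℝ} (h : IsWeakDeriv (f : AddCircle L → ℝ) v) :
    ∃ u : C(AddCircle L, ℝ), toL2 u = f ∧ (u, v) ∈ sobolevPairs L ℝ := by
  obtain ⟨u, hu, hmem⟩ := exists_mem_sobolevPairs_complex (isWeakDeriv_ofReal h)
  have hback : ∀ g : L2 L ℝ,
      Complex.reCLM.compLpL 2 volume (Complex.ofRealCLM.compLpL 2 volume g) = g := by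
    intro g
    apply Lp.ext
    filter_upwards [Complex.reCLM.coeFn_compLpL (p := 2) (μ := volume)
      (Complex.ofRealCLM.compLpL 2 volume g),
      Complex.ofRealCLM.coeFn_compLpL (p := 2) (μ := volume) g] with x h1 h2
    rw [h1, h2]
    simp
  have h1 := comp_mem_sobolevPairs Complex.reCLM hmem
  rw [hback] at h1
  refine ⟨_, ?_, h1⟩
  rw [← hback f, ← hu]
  apply Lp.ext
  filter_upwards [Complex.reCLM.coeFn_compLpL (p := 2) (μ := volume) (toL2 u),
    coeFn_toL2 (Complex.reCLM.compLeftContinuous ℝ _ u), coeFn_toL2 u] with x h1 h2 h3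
  rw [h1, h2, h3]
  rfl

/-! ### Chain rule and separation by test functions -/

/-- The chain rule in `H¹`, for functions bounded below by a positive constant. -/
lemma chain_mem_sobolevPairs {f f' : ℝ → ℝ} (hf : ContDiffOn ℝ ∞ f (Ioi 0))
    (hf' : ∀ x, 0 < x → HasDerivAt f (f' x) x) {δ : ℝ} (hδ : 0 < δ)
    {q : Pair L ℝ} (hq : q ∈ sobolevPairs L ℝ) (hqδ : ∀ x, δ ≤ q.1 x)
    {u k : C(AddCircle L, ℝ)} (hu : ∀ x, u x = f (q.1 x)) (hk : ∀ x, k x = f' (q.1 x)) :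
    (u, mulL2 (ContinuousLinearMap.mul ℝ ℝ) k q.2) ∈ sobolevPairs L ℝ := by
  -- Truncating the argument below `δ / 2` makes `f` and `f'` continuous on the whole line, so that
  -- composition with them is continuous on `C`.
  have hm : ∀ y : ℝ, 0 < max y (δ / 2) := fun y => lt_max_of_lt_right (by linarith)
  have hf'c : ContinuousOn f' (Ioi 0) := by
    have h1 := hf.continuousOn_deriv_of_isOpen isOpen_Ioi (by simp)
    exact h1.congr fun x hx => (hf' x hx).deriv.symm
  let fc : C(ℝ, ℝ) := ⟨fun y => f (max y (δ / 2)),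
    hf.continuousOn.comp_continuous (by fun_prop) hm⟩
  let gc : C(ℝ, ℝ) := ⟨fun y => f' (max y (δ / 2)), hf'c.comp_continuous (by fun_prop) hm⟩
  have hcont : Continuous fun q : Pair L ℝ =>
      ((fc.comp q.1, mulL2 (ContinuousLinearMap.mul ℝ ℝ) (gc.comp q.1) q.2) :
        Pair L ℝ) := by
    have h1 : Continuous fun q : Pair L ℝ => fc.comp q.1 :=
      (ContinuousMap.continuous_postcomp fc).comp continuous_fst
    have h2 : Continuous fun q : Pair L ℝ => gc.comp q.1 :=
      (ContinuousMap.continuous_postcomp gc).comp continuous_fst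
    have h3 : Continuous fun q : Pair L ℝ =>
        mulL2 (ContinuousLinearMap.mul ℝ ℝ) (gc.comp q.1) q.2 :=
      ((mulL2 (ContinuousLinearMap.mul ℝ ℝ)).continuous.comp h2).clm_apply continuous_snd
    exact h1.prodMk h3
  have h1 : u = fc.comp q.1 := by
    ext x
    change u x = f (max (q.1 x) (δ / 2))
    rw [hu, max_eq_left (by linarith [hqδ x])]
  have h2 : k = gc.comp q.1 := by
    ext x
    change k x = f' (max (q.1 x) (δ / 2))
    rw [hk, max_eq_left (by linarith [hqδ x])]
  rw [h1, h2]
  -- Smooth pairs uniformly close to `q` stay above the truncation.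
  let o : Set (Pair L ℝ) := {r | dist r.1 q.1 < δ / 2}
  have ho : IsOpen o := isOpen_lt (by fun_prop) continuous_const
  have hqo : q ∈ closure (o ∩ (smoothPairs L ℝ : Set (Pair L ℝ))) :=
    ho.inter_closure ⟨by simp only [o, mem_ofPred_eq, dist_self]; linarith, hq⟩
  refine map_mem_closure (t := (smoothPairs L ℝ : Set (Pair L ℝ)))
    (f := fun q => (fc.comp q.1, mulL2 (ContinuousLinearMap.mul ℝ ℝ) (gc.comp q.1) q.2))
    hcont hqo ?_
  rintro a ⟨ha, d, ha1, ha2, ha3⟩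
  have hlow : ∀ x, δ / 2 < a.1 x := by
    intro x
    have h3 := (ContinuousMap.dist_apply_le_dist (f := a.1) (g := q.1) x).trans_lt ha
    rw [Real.dist_eq, abs_lt] at h3
    linarith [hqδ x, h3.1]
  have hpos : ∀ x, 0 < a.1 x := fun x => lt_trans (by linarith) (hlow x)
  have h4 : ∀ x, fc.comp a.1 x = f (a.1 x) := fun x => by
    change f (max (a.1 x) (δ / 2)) = _
    rw [max_eq_left (hlow x).le]
  have h5 : ∀ x, gc.comp a.1 x = f' (a.1 x) := fun x => by
    change f' (max (a.1 x) (δ / 2)) = _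
    rw [max_eq_left (hlow x).le]
  refine ⟨mulC (ContinuousLinearMap.mul ℝ ℝ) (gc.comp a.1) d, ?_, fun s => ?_, ?_⟩
  · simp only [h4]
    exact hf.comp_contDiff ha1 fun s => hpos s
  · simp only [h4, mulC_apply, h5]
    exact (hf' _ (hpos s)).comp s (ha2 s)
  · simp only [ha3, mulL2_toL2]

/-- Smooth functions separate the points of `L²`. -/
lemma eq_zero_of_forall_integral_smooth {v : L2 L ℝ}
    (h : ∀ q ∈ smoothPairs L ℝ, ∫ x, v x * q.1 x = 0) : v = 0 := by
  have h1 : Complex.ofRealCLM.compLpL 2 volume v = 0 := by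
    have h2 := hasSum_expC (Complex.ofRealCLM.compLpL 2 volume v)
    refine h2.unique ?_
    convert! (hasSum_zero : HasSum (fun _ : ℤ => (0 : L2 L ℂ)) 0) using 2 with k
    have hk : inner ℂ (toL2 (expC L k)) (Complex.ofRealCLM.compLpL 2 volume v) = 0 := by
      rw [inner_toL2_left]
      have hi := integrable_mul_continuous (Complex.ofRealCLM.compLpL 2 volume v)
        (star (expC L k))
      have h3 := Complex.ofRealCLM.coeFn_compLpL (p := 2) (μ := volume) v
      have h4 : ∀ A : ℂ →L[ℝ] ℝ, ∫ x, v x * A (expC L k x) = 0 := fun A =>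
        h (A.compLeftContinuous ℝ _ (expC L k), toL2 (A.compLeftContinuous ℝ _
          (freq L k • expC L k))) ⟨A.compLeftContinuous ℝ _ (freq L k • expC L k),
            A.contDiff.comp (contDiff_expC k), fun s =>
            A.hasFDerivAt.comp_hasDerivAt s (hasDerivAt_expC k s), rfl⟩
      refine Complex.ext ?_ ?_
      · refine (integral_re (𝕜 := ℂ) hi).symm.trans (Eq.trans (integral_congr_ae ?_)
          (h4 Complex.reCLM))
        filter_upwards [h3] with x hx
        simp [hx]
      · refine (integral_im (𝕜 := ℂ) hi).symm.trans (Eq.trans (integral_congr_ae ?_)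
          (h4 (-Complex.imCLM)))
        filter_upwards [h3] with x hx
        simp [hx]
    rw [hk, zero_smul]
  apply Lp.ext
  have h3 := Complex.ofRealCLM.coeFn_compLpL (p := 2) (μ := volume) v
  rw [h1] at h3
  filter_upwards [h3, Lp.coeFn_zero ℂ 2 (volume : Measure (AddCircle L)),
    Lp.coeFn_zero ℝ 2 (volume : Measure (AddCircle L))] with x h4 h5 h6
  rw [h5] at h4
  rw [h6]
  exact Complex.ofReal_injective h4.symm

/-! ### Calculus in time -/

lemma hasDerivAt_integral_of_continuousOn {X : Type*} [NormedAddCommGroup X] [NormedSpace ℝ X]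
    [CompleteSpace X] {g : ℝ → X} {a b t : ℝ} (hg : ContinuousOn g (Icc a b))
    (ht : t ∈ Ioo a b) : HasDerivAt (fun s => ∫ r in a..s, g r) (g t) t := by
  refine intervalIntegral.integral_hasDerivAt_right ?_ ?_ ?_
  · refine (hg.mono ?_).intervalIntegrable
    rw [uIcc_of_le ht.1.le]
    exact Icc_subset_Icc_right ht.2.le
  · exact (hg.mono Ioo_subset_Icc_self).stronglyMeasurableAtFilter isOpen_Ioo t ht
  · exact hg.continuousAt (Icc_mem_nhds ht.1 ht.2)

/-- A curve in a Banach space whose derivative exists when tested with a separating family of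
functionals, and is continuous in norm, is an integral curve. -/
lemma eq_integral_of_functionals {X : Type*} [NormedAddCommGroup X] [NormedSpace ℝ X]
    [CompleteSpace X] {ι : Type*} (l : ι → X →L[ℝ] ℝ) (hsep : ∀ x, (∀ i, l i x = 0) → x = 0)
    {f g : ℝ → X} {a b : ℝ} (hg : ContinuousOn g (Icc a b))
    (hc : ∀ i, ContinuousOn (fun t => l i (f t)) (Icc a b))
    (hd : ∀ i, ∀ t ∈ Ioo a b, HasDerivAt (fun t => l i (f t)) (l i (g t)) t)
    {t : ℝ} (ht : t ∈ Icc a b) : f t = f a + ∫ s in a..t, g s := by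
  rw [← sub_eq_iff_eq_add', ← sub_eq_zero]
  refine hsep _ fun i => ?_
  have hsub : Icc a t ⊆ Icc a b := Icc_subset_Icc_right ht.2
  have hint : IntervalIntegrable g volume a t :=
    (hg.mono (by rwa [uIcc_of_le ht.1])).intervalIntegrable
  have h1 := intervalIntegral.integral_eq_sub_of_hasDerivAt_of_le ht.1 ((hc i).mono hsub)
    (fun s hs => hd i s ⟨hs.1, hs.2.trans_le ht.2⟩)
    (((l i).continuous.comp_continuousOn (hg.mono hsub)).intervalIntegrable_of_Icc ht.1)
  rw [map_sub, map_sub, ← h1, sub_eq_zero, ContinuousLinearMap.intervalIntegral_comp_comm _ hint]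

/-- The differential form of `eq_integral_of_functionals`. -/
lemma hasDerivAt_of_functionals {X : Type*} [NormedAddCommGroup X] [NormedSpace ℝ X]
    [CompleteSpace X] {ι : Type*} (l : ι → X →L[ℝ] ℝ) (hsep : ∀ x, (∀ i, l i x = 0) → x = 0)
    {f g : ℝ → X} {a b : ℝ} (hg : ContinuousOn g (Icc a b))
    (hc : ∀ i, ContinuousOn (fun t => l i (f t)) (Icc a b))
    (hd : ∀ i, ∀ t ∈ Ioo a b, HasDerivAt (fun t => l i (f t)) (l i (g t)) t)
    {t : ℝ} (ht : t ∈ Ioo a b) : HasDerivAt f (g t) t := by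
  refine ((hasDerivAt_integral_of_continuousOn hg ht).const_add (f a)).congr_of_eventuallyEq ?_
  filter_upwards [Ioo_mem_nhds ht.1 ht.2] with s hs
  exact eq_integral_of_functionals l hsep hg hc hd (Ioo_subset_Icc_self hs)

/-- A product whose first factor vanishes at the base point is differentiable as soon as the
second factor is continuous. -/
lemma hasDerivAt_bilin_of_eq_zero {X Y Z : Type*} [NormedAddCommGroup X] [NormedSpace ℝ X]
    [NormedAddCommGroup Y] [NormedSpace ℝ Y] [NormedAddCommGroup Z] [NormedSpace ℝ Z]
    (B : X →L[ℝ] Y →L[ℝ] Z) {f : ℝ → X} {q : ℝ → Y} {f' : X} {t : ℝ} (hf : HasDerivAt f f' t)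
    (h0 : f t = 0) (hq : ContinuousAt q t) :
    HasDerivAt (fun s => B (f s) (q s)) (B f' (q t)) t := by
  rw [hasDerivAt_iff_tendsto_slope] at hf ⊢
  have h1 : Tendsto (fun s => B (slope f t s) (q s)) (𝓝[≠] t) (𝓝 (B f' (q t))) :=
    (isBoundedBilinearMap_apply.continuous.tendsto (B f', q t)).comp
      (((B.continuous.tendsto f').comp hf).prodMk_nhds
        (hq.tendsto.mono_left nhdsWithin_le_nhds))
  refine h1.congr fun s => ?_
  simp [slope_def_module, h0]

/-- The energy identity for a skew-adjoint evolution, diagonal in a Hilbert basis, with a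
continuous source `g`. -/
lemma hasDerivAt_norm_sq_of_skew {H : Type*} [NormedAddCommGroup H] [InnerProductSpace ℂ H]
    {ι : Type*} [Countable ι] (b : HilbertBasis ι ℂ H) {V g : ℝ → H} {T t : ℝ} {μ : ι → ℝ}
    (hV : ContinuousOn V (Icc 0 T)) (hg : ContinuousOn g (Icc 0 T))
    (hd : ∀ k, ∀ t ∈ Ioo 0 T, HasDerivAt (fun s => inner ℂ (b k) (V s))
      (Complex.I * μ k * inner ℂ (b k) (V t) + inner ℂ (b k) (g t)) t) (ht : t ∈ Ioo 0 T) :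
    HasDerivAt (fun s => ‖V s‖ ^ 2) (2 * (inner ℂ (V t) (g t)).re) t := by
  have hcont : ContinuousOn (fun s => 2 * (inner ℂ (V s) (g s)).re) (Icc 0 T) :=
    continuousOn_const.mul (Complex.continuous_re.comp_continuousOn (hV.inner (𝕜 := ℂ) hg))
  have hsumsq : ∀ x : H, HasSum (fun k => ‖inner ℂ (b k) x‖ ^ 2) (‖x‖ ^ 2) := by
    intro x
    have h1 := Complex.hasSum_re (b.hasSum_inner_mul_inner x x)
    convert! h1 using 1
    · ext k
      have h2 := inner_mul_symm_re_eq_norm (𝕜 := ℂ) x (b k)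
      rw [norm_mul, norm_inner_symm x, ← sq] at h2
      exact h2.symm
    · rw [inner_self_eq_norm_sq_to_K]
      norm_cast
  have key : ∀ s ∈ Icc 0 T, ‖V s‖ ^ 2 = ‖V 0‖ ^ 2 +
      ∫ r in (0 : ℝ)..s, 2 * (inner ℂ (V r) (g r)).re := by
    intro s hs
    have hsub : Icc 0 s ⊆ Icc 0 T := Icc_subset_Icc_right hs.2
    have hIoc : ∀ r ∈ uIoc 0 s, r ∈ Icc 0 T := fun r hr => by
      rw [uIoc_of_le hs.1] at hr
      exact ⟨hr.1.le, hr.2.trans hs.2⟩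
    have hak : ∀ k, ContinuousOn (fun r => inner ℂ (b k) (V r)) (Icc 0 T) := fun k =>
      continuousOn_const.inner hV
    have hgk : ∀ k, ContinuousOn (fun r => inner ℂ (b k) (g r)) (Icc 0 T) := fun k =>
      continuousOn_const.inner hg
    have hFc : ∀ k, ContinuousOn (fun r => 2 * (inner ℂ (V r) (b k) * inner ℂ (b k) (g r)).re)
        (Icc 0 T) := fun k => continuousOn_const.mul
      (Complex.continuous_re.comp_continuousOn ((hV.inner continuousOn_const).mul (hgk k)))
    -- The skew part drops out of the evolution of the modulus of each coefficient.
    have hmode : ∀ k, ∫ r in (0 : ℝ)..s, 2 * (inner ℂ (V r) (b k) * inner ℂ (b k) (g r)).re =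
        ‖inner ℂ (b k) (V s)‖ ^ 2 - ‖inner ℂ (b k) (V 0)‖ ^ 2 := by
      intro k
      refine intervalIntegral.integral_eq_sub_of_hasDerivAt_of_le
        (f := fun r => ‖inner ℂ (b k) (V r)‖ ^ 2) hs.1 (((hak k).norm.pow 2).mono hsub)
        (fun r hr => ?_) (((hFc k).mono hsub).intervalIntegrable_of_Icc hs.1)
      have h1 := (hd k r ⟨hr.1, hr.2.trans_le hs.2⟩).norm_sq
      refine h1.congr_deriv ?_
      rw [← inner_conj_symm (V r) (b k)]
      generalize inner ℂ (b k) (V r) = z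
      generalize inner ℂ (b k) (g r) = w
      simp only [Complex.inner, Complex.mul_re, Complex.mul_im, Complex.add_re, Complex.add_im,
        Complex.conj_re, Complex.conj_im, Complex.I_re, Complex.I_im, Complex.ofReal_re,
        Complex.ofReal_im]
      ring
    have hsum := intervalIntegral.hasSum_integral_of_dominated_convergence (μ := volume)
      (a := 0) (b := s)
      (F := fun k r => 2 * (inner ℂ (V r) (b k) * inner ℂ (b k) (g r)).re)
      (f := fun r => 2 * (inner ℂ (V r) (g r)).re)
      (fun k r => ‖inner ℂ (b k) (V r)‖ ^ 2 + ‖inner ℂ (b k) (g r)‖ ^ 2)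
      (fun k => (((hFc k).mono hIoc).aestronglyMeasurable measurableSet_uIoc))
      (fun k => Eventually.of_forall fun r _ => by
        rw [norm_mul, Real.norm_ofNat, Real.norm_eq_abs]
        have h1 := Complex.abs_re_le_norm (inner ℂ (V r) (b k) * inner ℂ (b k) (g r))
        rw [norm_mul, norm_inner_symm (V r)] at h1
        nlinarith [sq_nonneg (‖inner ℂ (b k) (V r)‖ - ‖inner ℂ (b k) (g r)‖)])
      (Eventually.of_forall fun r _ => ((hsumsq (V r)).add (hsumsq (g r))).summable)
      (by
        have h1 : (fun r => ∑' k, (‖inner ℂ (b k) (V r)‖ ^ 2 + ‖inner ℂ (b k) (g r)‖ ^ 2)) =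
            fun r => ‖V r‖ ^ 2 + ‖g r‖ ^ 2 := by
          ext r
          exact ((hsumsq (V r)).add (hsumsq (g r))).tsum_eq
        rw [h1]
        exact (((hV.norm.pow 2).add (hg.norm.pow 2)).mono hsub).intervalIntegrable_of_Icc hs.1)
      (Eventually.of_forall fun r _ =>
        (Complex.hasSum_re (b.hasSum_inner_mul_inner (V r) (g r))).mul_left 2)
    simp only [hmode] at hsum
    have h2 := hsum.unique ((hsumsq (V s)).sub (hsumsq (V 0)))
    rw [h2]
    ring
  refine ((hasDerivAt_integral_of_continuousOn hcont ht).const_add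
    (‖V 0‖ ^ 2)).congr_of_eventuallyEq ?_
  filter_upwards [Ioo_mem_nhds ht.1 ht.2] with s hs
  exact key s (Ioo_subset_Icc_self hs)

/-! ### Algebra of pairs and strong solutions -/

/-- The product of pairs along a bilinear map, by the Leibniz rule. -/
def Pair.mul (B : E →L[ℝ] F →L[ℝ] G) (q : Pair L E) (r : Pair L F) : Pair L G :=
  (mulC B q.1 r.1, mulL2 B q.1 r.2 + mulL2 B.flip r.1 q.2)

/-- The image of a pair under a linear map. -/
def Pair.map (A : E →L[ℝ] F) (q : Pair L E) : Pair L F :=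
  (A.compLeftContinuous ℝ (AddCircle L) q.1, A.compLpL 2 volume q.2)

variable (L) in
/-- The constant function `c`. -/
def Pair.const (c : E) : Pair L E := (ContinuousMap.const _ c, 0)

lemma Pair.continuousOn_mul (B : E →L[ℝ] F →L[ℝ] G) {q : ℝ → Pair L E} {r : ℝ → Pair L F}
    {s : Set ℝ} (hq : ContinuousOn q s) (hr : ContinuousOn r s) :
    ContinuousOn (fun t => Pair.mul B (q t) (r t)) s := by
  refine ContinuousOn.prodMk ((continuous_mulC B).comp_continuousOn (hq.fst.prodMk hr.fst)) ?_
  exact (((mulL2 B).continuous.comp_continuousOn hq.fst).clm_apply hr.snd).add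
    (((mulL2 B.flip).continuous.comp_continuousOn hr.fst).clm_apply hq.snd)

lemma Pair.continuousOn_map (A : E →L[ℝ] F) {q : ℝ → Pair L E} {s : Set ℝ}
    (hq : ContinuousOn q s) : ContinuousOn (fun t => Pair.map A (q t)) s :=
  ((A.compLeftContinuous ℝ (AddCircle L)).continuous.comp_continuousOn hq.fst).prodMk
    ((A.compLpL 2 volume).continuous.comp_continuousOn hq.snd)

lemma Pair.mul_snd_ae (B : E →L[ℝ] F →L[ℝ] G) (q : Pair L E) (r : Pair L F) :
    ((Pair.mul B q r).2 : AddCircle L → G) =ᵐ[volume]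
      fun x => B (q.1 x) (r.2 x) + B (q.2 x) (r.1 x) := by
  filter_upwards [Lp.coeFn_add (mulL2 B q.1 r.2) (mulL2 B.flip r.1 q.2),
    coeFn_mulL2 B q.1 r.2, coeFn_mulL2 B.flip r.1 q.2] with x h1 h2 h3
  change (mulL2 B q.1 r.2 + mulL2 B.flip r.1 q.2 : L2 L G) x = _
  rw [h1, Pi.add_apply, h2, h3, ContinuousLinearMap.flip_apply]

lemma Pair.map_snd_ae (A : E →L[ℝ] F) (q : Pair L E) :
    ((Pair.map A q).2 : AddCircle L → F) =ᵐ[volume] fun x => A (q.2 x) :=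
  A.coeFn_compLpL q.2

/-- The map `(u, ∂ₓu) ↦ (|u|², 2 Re (ū ∂ₓu))`. -/
def density (q : Pair L ℂ) : Pair L ℝ := Pair.mul (innerSL ℝ) q q

/-- The nonlinear potential `λn + g|ψ|²`. -/
def potential (p : Params) (q : Pair L ℂ) (r : Pair L ℝ) : Pair L ℝ :=
  p.lam • r + p.g • density q

/-- The conservative nonlinearity `(λn + g|ψ|²)ψ`. -/
def interaction (p : Params) (q : Pair L ℂ) (r : Pair L ℝ) : Pair L ℂ :=
  Pair.mul (ContinuousLinearMap.lsmul ℝ ℝ) (potential p q r) q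

/-- The net gain `Rn - α`. -/
def gain (p : Params) (r : Pair L ℝ) : Pair L ℝ := p.R • r - Pair.const L p.α

/-- The terms of `∂ₜψ` of order zero, `-i(λn + g|ψ|²)ψ + ½(Rn - α)ψ`. -/
def source (p : Params) (q : Pair L ℂ) (r : Pair L ℝ) : Pair L ℂ :=
  Pair.map (ContinuousLinearMap.mul ℝ ℂ (-Complex.I)) (interaction p q r) +
    (1 / 2 : ℝ) • Pair.mul (ContinuousLinearMap.lsmul ℝ ℝ) (gain p r) q

/-- The loss rate `R|ψ|² + β`. -/
def loss (p : Params) (q : Pair L ℂ) : Pair L ℝ := p.R • density q + Pair.const L p.β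

/-- The time derivative `ε⁻¹(P - (R|ψ|² + β)n)` of `n`. -/
def rate (p : Params) (ε : ℝ) (q : Pair L ℂ) (r : Pair L ℝ) : Pair L ℝ :=
  ε⁻¹ • (Pair.const L p.P - Pair.mul (ContinuousLinearMap.mul ℝ ℝ) (loss p q) r)

section Mem

variable {p : Params} {q : Pair L ℂ} {r : Pair L ℝ} (hq : q ∈ sobolevPairs L ℂ)
  (hr : r ∈ sobolevPairs L ℝ)
include hq

lemma density_mem : density q ∈ sobolevPairs L ℝ := mul_mem_sobolevPairs _ hq hq

lemma loss_mem : loss p q ∈ sobolevPairs L ℝ :=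
  Submodule.add_mem _ (Submodule.smul_mem _ _ (density_mem hq)) (const_mem_sobolevPairs _)

include hr

lemma potential_mem : potential p q r ∈ sobolevPairs L ℝ :=
  Submodule.add_mem _ (Submodule.smul_mem _ _ hr) (Submodule.smul_mem _ _ (density_mem hq))

lemma interaction_mem : interaction p q r ∈ sobolevPairs L ℂ :=
  mul_mem_sobolevPairs _ (potential_mem hq hr) hq

lemma source_mem : source p q r ∈ sobolevPairs L ℂ :=
  Submodule.add_mem _ (comp_mem_sobolevPairs _ (interaction_mem hq hr))
    (Submodule.smul_mem _ _ (mul_mem_sobolevPairs _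
      (Submodule.sub_mem _ (Submodule.smul_mem _ _ hr) (const_mem_sobolevPairs _)) hq))

end Mem

section Cont

variable {p : Params} {ε : ℝ} {q : ℝ → Pair L ℂ} {r : ℝ → Pair L ℝ} {s : Set ℝ}
  (hq : ContinuousOn q s) (hr : ContinuousOn r s)
include hq

lemma continuousOn_density : ContinuousOn (fun t => density (q t)) s :=
  Pair.continuousOn_mul _ hq hq

lemma continuousOn_loss : ContinuousOn (fun t => loss p (q t)) s :=
  ((continuousOn_density hq).const_smul p.R).add continuousOn_const

include hr

lemma continuousOn_potential : ContinuousOn (fun t => potential p (q t) (r t)) s :=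
  (hr.const_smul p.lam).add ((continuousOn_density hq).const_smul p.g)

lemma continuousOn_source : ContinuousOn (fun t => source p (q t) (r t)) s :=
  (Pair.continuousOn_map _ (Pair.continuousOn_mul _ (continuousOn_potential hq hr) hq)).add
    ((Pair.continuousOn_mul _ ((hr.const_smul p.R).sub continuousOn_const) hq).const_smul
      (1 / 2 : ℝ))

lemma continuousOn_rate : ContinuousOn (fun t => rate p ε (q t) (r t)) s :=
  (continuousOn_const.sub (Pair.continuousOn_mul _ (continuousOn_loss hq) hr)).const_smul ε⁻¹

end Cont

lemma density_fst (q : Pair L ℂ) (x : AddCircle L) : (density q).1 x = ‖q.1 x‖ ^ 2 := by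
  change inner ℝ (q.1 x) (q.1 x) = _
  rw [real_inner_self_eq_norm_sq]

lemma density_snd_ae (q : Pair L ℂ) : ((density q).2 : AddCircle L → ℝ) =ᵐ[volume]
    fun x => 2 * inner ℝ (q.1 x) (q.2 x) := by
  filter_upwards [Pair.mul_snd_ae (innerSL ℝ) q q] with x hx
  change (Pair.mul (innerSL ℝ) q q).2 x = _
  rw [hx, innerSL_apply_apply, innerSL_apply_apply, real_inner_comm (q.1 x) (q.2 x), two_mul]

lemma potential_fst (p : Params) (q : Pair L ℂ) (r : Pair L ℝ) (x : AddCircle L) :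
    (potential p q r).1 x = p.lam * r.1 x + p.g * ‖q.1 x‖ ^ 2 := by
  rw [← density_fst]; rfl

lemma interaction_fst (p : Params) (q : Pair L ℂ) (r : Pair L ℝ) (x : AddCircle L) :
    (interaction p q r).1 x = (p.lam * r.1 x + p.g * ‖q.1 x‖ ^ 2) • q.1 x := by
  rw [← potential_fst]; rfl

lemma source_fst (p : Params) (q : Pair L ℂ) (r : Pair L ℝ) (x : AddCircle L) :
    (source p q r).1 x = -Complex.I * (interaction p q r).1 x +
      (1 / 2 : ℝ) • ((p.R * r.1 x - p.α) • q.1 x) := rfl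

lemma loss_fst (p : Params) (q : Pair L ℂ) (x : AddCircle L) :
    (loss p q).1 x = p.R * ‖q.1 x‖ ^ 2 + p.β := by
  rw [← density_fst]; rfl

lemma rate_fst (p : Params) (ε : ℝ) (q : Pair L ℂ) (r : Pair L ℝ) (x : AddCircle L) :
    (rate p ε q r).1 x = ε⁻¹ * (p.P - (p.R * ‖q.1 x‖ ^ 2 + p.β) * r.1 x) := by
  rw [← loss_fst]; rfl

/-- A solution on `[0, T]` in terms of continuous representatives, with the equations tested
against smooth pairs in the interior of the time interval. -/
structure IsPairSolution (p : Params) (ε T : ℝ) (u : ℝ → Pair L ℂ) (n : ℝ → Pair L ℝ) : Prop where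
  u_mem : ∀ t, u t ∈ sobolevPairs L ℂ
  n_mem : ∀ t, n t ∈ sobolevPairs L ℝ
  u_cont : ContinuousOn u (Icc 0 T)
  n_cont : ContinuousOn n (Icc 0 T)
  u_eq : ∀ q ∈ smoothPairs L ℂ, ∀ t ∈ Ioo 0 T,
    HasDerivAt (fun s => ∫ x, (u s).1 x * q.1 x)
      (∫ x, (-(Complex.I / 2) * (u t).2 x * q.2 x + (source p (u t) (n t)).1 x * q.1 x)) t
  n_eq : ∀ q ∈ smoothPairs L ℝ, ∀ t ∈ Ioo 0 T,
    HasDerivAt (fun s => ∫ x, (n s).1 x * q.1 x)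
      (∫ x, (rate p ε (u t) (n t)).1 x * q.1 x) t

/-- On `H¹` the topology of `C × L²` is that of `L² × L²`. -/
lemma continuousOn_of_L2 [CompleteSpace E] {q : ℝ → Pair L E} (hq : ∀ t, q t ∈ sobolevPairs L E)
    {s : Set ℝ} (h1 : ContinuousOn (fun t => toL2 (q t).1) s)
    (h2 : ContinuousOn (fun t => (q t).2) s) : ContinuousOn q s := by
  refine ContinuousOn.prodMk ?_ h2
  intro t ht
  have h3 := tendsto_iff_norm_sub_tendsto_zero.1 (h1 t ht)
  have h4 := tendsto_iff_norm_sub_tendsto_zero.1 (h2 t ht)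
  have h5 := (h3.add h4).const_mul (sobolevConst L)
  simp only [add_zero, mul_zero] at h5
  refine tendsto_iff_norm_sub_tendsto_zero.2
    (squeeze_zero (fun _ => norm_nonneg _) (fun r => ?_) h5)
  have h6 := norm_le_of_mem_sobolevPairs (Submodule.sub_mem _ (hq r) (hq t))
  rwa [Prod.fst_sub, Prod.snd_sub, map_sub] at h6

/-- Every solution is represented by a solution in terms of pairs. -/
lemma IsSolution.exists_isPairSolution {p : Params} {ε : ℝ} (hε : 0 < ε) {T : EReal}
    {ψ : ℝ → H1 L ℂ} {n : ℝ → H1 L ℝ} (h : IsSolution p ε T ψ n) {T₁ : ℝ}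
    (hT : T₁ ∈ timeInterval T) :
    ∃ (u : ℝ → Pair L ℂ) (m : ℝ → Pair L ℝ), IsPairSolution p ε T₁ u m ∧
      (∀ t, toL2 (u t).1 = (ψ t).1.1 ∧ (u t).2 = (ψ t).1.2) ∧
      (∀ t, toL2 (m t).1 = (n t).1.1 ∧ (m t).2 = (n t).1.2) := by
  choose u hu1 hu2 using fun t => exists_mem_sobolevPairs_complex (ψ t).2
  choose m hm1 hm2 using fun t => exists_mem_sobolevPairs_real (n t).2
  have hsub : Icc 0 T₁ ⊆ timeInterval T := fun t ht =>
    ⟨ht.1, lt_of_le_of_lt (by exact_mod_cast ht.2) hT.2⟩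
  have hnhds : ∀ t ∈ Ioo 0 T₁, timeInterval T ∈ 𝓝 t := fun t ht =>
    mem_of_superset (Icc_mem_nhds ht.1 ht.2) hsub
  have hu : ∀ t, (ψ t).fn =ᵐ[volume] u t := fun t => by
    have := coeFn_toL2 (u t); rw [hu1] at this; exact this
  have hm : ∀ t, (n t).fn =ᵐ[volume] m t := fun t => by
    have := coeFn_toL2 (m t); rw [hm1] at this; exact this
  refine ⟨fun t => (u t, (ψ t).1.2), fun t => (m t, (n t).1.2), ⟨hu2, hm2, ?_, ?_, ?_, ?_⟩,
    fun t => ⟨hu1 t, rfl⟩, fun t => ⟨hm1 t, rfl⟩⟩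
  · have h1 := continuous_subtype_val.comp_continuousOn (h.continuousOn_psi.mono hsub)
    refine continuousOn_of_L2 hu2 ?_ h1.snd
    simp only [hu1]
    exact h1.fst
  · have h1 := continuous_subtype_val.comp_continuousOn (h.continuousOn_n.mono hsub)
    refine continuousOn_of_L2 hm2 ?_ h1.snd
    simp only [hm1]
    exact h1.fst
  · rintro ⟨φ, d'⟩ ⟨d, hs, hs', hd⟩ t ht
    obtain rfl : d' = toL2 d := hd
    have h1 := ((h.eq_psi φ hs t (hsub (Ioo_subset_Icc_self ht))).hasDerivAt
      (hnhds t ht)).const_mul (-Complex.I)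
    convert! h1 using 1
    · ext s
      rw [← mul_assoc, neg_mul, Complex.I_mul_I, neg_neg, one_mul]
      refine integral_congr_ae ?_
      filter_upwards [hu s] with x hx
      rw [hx]
    · rw [← integral_const_mul]
      refine integral_congr_ae ?_
      filter_upwards [hu t, hm t, coeFn_toL2 d] with x h2 h3 h4
      rw [h2, h3, h4, torusDeriv_eq hs', source_fst, interaction_fst]
      simp only [Complex.real_smul, H1.dx]
      push_cast
      linear_combination ((1 / 2 : ℂ) * ((p.R : ℂ) * m t x - p.α) * u t x * φ x) * Complex.I_mul_I
  · rintro ⟨φ, d'⟩ ⟨d, hs, hs', hd⟩ t ht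
    have h1 := ((h.eq_n φ hs t (hsub (Ioo_subset_Icc_self ht))).hasDerivAt
      (hnhds t ht)).const_mul ε⁻¹
    convert! h1 using 1
    · ext s
      rw [← mul_assoc, inv_mul_cancel₀ hε.ne', one_mul]
      refine integral_congr_ae ?_
      filter_upwards [hm s] with x hx
      rw [hx]
    · rw [← integral_const_mul]
      refine integral_congr_ae ?_
      filter_upwards [hu t, hm t] with x h2 h3
      rw [h2, h3, rate_fst]
      ring

/-! ### The kinetic energy -/

lemma real_inner_L2 (v w : L2 L ℂ) : inner ℝ v w = (inner ℂ v w).re := by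
  rw [L2.inner_def, L2.inner_def]
  exact integral_re (𝕜 := ℂ) (L2.integrable_inner v w)

section

variable {p : Params} {ε T : ℝ} {u : ℝ → Pair L ℂ} {n : ℝ → Pair L ℝ}
  (hS : IsPairSolution p ε T u n) {t : ℝ} (ht : t ∈ Ioo 0 T)
include hS ht

/-- The Schrödinger part of the flow is skew-adjoint on the Fourier side, so that only the source
contributes to the kinetic energy. -/
lemma hasDerivAt_kinetic : HasDerivAt (fun s => ‖(u s).2‖ ^ 2)
    (2 * inner ℝ (u t).2 (source p (u t) (n t)).2) t := by
  rw [real_inner_L2]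
  refine hasDerivAt_norm_sq_of_skew (expBasis L) (V := fun s => (u s).2)
    (g := fun s => (source p (u s) (n s)).2) (μ := fun k => -(2 * Real.pi * k / L) ^ 2 / 2)
    hS.u_cont.snd (continuousOn_source hS.u_cont hS.n_cont).snd (fun k t ht => ?_) ht
  -- Differentiation in `x` is moved to the exponential, against which the equation can be tested.
  have hw : ∀ q ∈ sobolevPairs L ℂ, inner ℂ (toL2 (expC L k)) q.2 =
      freq L k * ∫ x, q.1 x * star (expC L k x) := by
    intro q hq
    rw [inner_expC_weakDeriv (isWeakDeriv_of_mem_sobolevPairs hq (coeFn_toL2 q.1)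
      EventuallyEq.rfl), inner_toL2_left]
    congr 1
    refine integral_congr_ae ?_
    filter_upwards [coeFn_toL2 q.1] with x hx
    rw [hx]
  have hstar : (star (expC L k), toL2 (star (freq L k • expC L k))) ∈ smoothPairs L ℂ :=
    ⟨star (freq L k • expC L k), (starL' ℝ : ℂ ≃L[ℝ] ℂ).contDiff.comp (contDiff_expC k),
      fun s => (hasDerivAt_expC k s).star, rfl⟩
  have h1 := (hS.u_eq _ hstar t ht).const_mul (freq L k)
  simp only [expBasis_apply, hw _ (hS.u_mem _)]
  convert! h1 using 1
  have h2 : ∫ x, (-(Complex.I / 2) * (u t).2 x * toL2 (star (freq L k • expC L k)) x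
      + (source p (u t) (n t)).1 x * star (expC L k) x) =
      Complex.I / 2 * freq L k * inner ℂ (toL2 (expC L k)) (u t).2 +
        ∫ x, (source p (u t) (n t)).1 x * star (expC L k x) := by
    rw [inner_toL2_left, ← integral_const_mul, ← integral_add]
    · refine integral_congr_ae ?_
      filter_upwards [coeFn_toL2 (star (freq L k • expC L k))] with x hx
      rw [hx]
      simp only [ContinuousMap.star_apply, ContinuousMap.smul_apply, smul_eq_mul, star_mul',
        freq_star]
      ring
    · exact ((integrable_mul_continuous (u t).2 (star (expC L k))).const_mul _)
    · exact Continuous.integrable_of_hasCompactSupport (by fun_prop)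
        (HasCompactSupport.of_compactSpace _)
  rw [h2, mul_add, ← hw _ (source_mem (hS.u_mem t) (hS.n_mem t)), ← hw _ (hS.u_mem t)]
  congr 1
  rw [← mul_assoc]
  congr 1
  simp only [freq]
  push_cast
  linear_combination (-(Complex.I / 2) * (2 * Real.pi * k / L) ^ 2) * Complex.I_mul_I

end

/-! ### The reservoir density -/

/-- The integral over the torus as a continuous functional on the continuous functions. -/
def intC : C(AddCircle L, ℝ) →L[ℝ] ℝ := intL2.comp toL2

lemma intC_apply (f : C(AddCircle L, ℝ)) : intC f = ∫ x, f x := by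
  change intL2 (toL2 f) = _
  rw [intL2_apply]
  exact integral_congr_ae (coeFn_toL2 f)

lemma real_inner_toL2_left (f : C(AddCircle L, ℝ)) (v : L2 L ℝ) :
    inner ℝ (toL2 f) v = ∫ x, v x * f x := by
  rw [L2.inner_def]
  refine integral_congr_ae ?_
  filter_upwards [coeFn_toL2 f] with x hx
  rw [hx, real_inner_eq_re_inner]
  simp

lemma real_inner_toL2_toL2 (f g : C(AddCircle L, ℝ)) :
    inner ℝ (toL2 f) (toL2 g) = intC (f * g) := by
  rw [real_inner_toL2_left, intC_apply]
  refine integral_congr_ae ?_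
  filter_upwards [coeFn_toL2 g] with x hx
  rw [hx, ContinuousMap.mul_apply, mul_comm]

lemma real_inner_by_parts {q r : Pair L ℝ} (hq : q ∈ sobolevPairs L ℝ)
    (hr : r ∈ sobolevPairs L ℝ) : inner ℝ (toL2 q.1) r.2 = -inner ℝ q.2 (toL2 r.1) := by
  rw [real_inner_comm (toL2 r.1), real_inner_toL2_left, real_inner_toL2_left]
  have h := integral_by_parts (ContinuousLinearMap.mul ℝ ℝ) hq hr
  simp only [ContinuousLinearMap.mul_apply'] at h
  rw [← h]
  simp only [mul_comm]

lemma eq_zero_of_forall_inner_smooth {v : L2 L ℝ}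
    (h : ∀ q : smoothPairs L ℝ, innerSL ℝ (toL2 q.1.1) v = 0) : v = 0 :=
  eq_zero_of_forall_integral_smooth fun q hq => by
    rw [← real_inner_toL2_left]
    exact h ⟨q, hq⟩

/-- Differentiability in time, uniformly in space, from pointwise differentiability. -/
lemma hasDerivAt_of_pointwise {f g : ℝ → C(AddCircle L, ℝ)} {a b t : ℝ}
    (hf : ContinuousOn f (Icc a b)) (hg : ContinuousOn g (Icc a b))
    (hd : ∀ x, ∀ t ∈ Ioo a b, HasDerivAt (fun s => f s x) (g t x) t) (ht : t ∈ Ioo a b) :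
    HasDerivAt f (g t) t := by
  refine hasDerivAt_of_functionals (fun x : AddCircle L => ContinuousMap.evalCLM ℝ x)
    (fun u hu => ContinuousMap.ext hu) hg (fun x => ?_) hd ht
  exact (ContinuousMap.evalCLM ℝ x).continuous.comp_continuousOn hf

/-- The function `√·` as a continuous function. -/
def sqrtC : C(ℝ, ℝ) := ⟨Real.sqrt, Real.continuous_sqrt⟩

/-- The function `1 / √·`, truncated below `δ` in order to be continuous. -/
def invSqrtC {δ : ℝ} (hδ : 0 < δ) : C(ℝ, ℝ) :=
  ⟨fun y => (√(max y δ))⁻¹, Continuous.inv₀ (by fun_prop)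
    fun y => (Real.sqrt_pos.2 (lt_max_of_lt_right hδ)).ne'⟩

/-- The logarithm, truncated below `δ` in order to be continuous. -/
def logC {δ : ℝ} (hδ : 0 < δ) : C(ℝ, ℝ) :=
  ⟨fun y => Real.log (max y δ), Continuous.log (by fun_prop)
    fun y => (lt_max_of_lt_right hδ).ne'⟩

/-- The pair `(√n, ∂ₓ√n)`, for `n ≥ δ`. -/
def sqrtPair {δ : ℝ} (hδ : 0 < δ) (n : Pair L ℝ) : Pair L ℝ :=
  (sqrtC.comp n.1, mulL2 (ContinuousLinearMap.mul ℝ ℝ) ((1 / 2 : ℝ) • (invSqrtC hδ).comp n.1) n.2)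

/-- The pair `(1/√n, ∂ₓ(1/√n))`, for `n ≥ δ`. -/
def invSqrtPair {δ : ℝ} (hδ : 0 < δ) (n : Pair L ℝ) : Pair L ℝ :=
  ((invSqrtC hδ).comp n.1, mulL2 (ContinuousLinearMap.mul ℝ ℝ)
    (-(1 / 2 : ℝ) • ((invSqrtC hδ).comp n.1) ^ 3) n.2)

/-- The time derivative `(P/√n - (R|ψ|² + β)√n) / (2ε)` of `√n`. -/
def sqrtRate (p : Params) (ε : ℝ) {δ : ℝ} (hδ : 0 < δ) (u : Pair L ℂ) (n : Pair L ℝ) : Pair L ℝ :=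
  (ε⁻¹ / 2) • (p.P • invSqrtPair hδ n -
    Pair.mul (ContinuousLinearMap.mul ℝ ℝ) (loss p u) (sqrtPair hδ n))

section Pointwise

variable {δ : ℝ} {hδ : 0 < δ} {n : Pair L ℝ} (hn : ∀ x, δ ≤ n.1 x)
include hn

lemma invSqrtC_comp (x : AddCircle L) : (invSqrtC hδ).comp n.1 x = (√(n.1 x))⁻¹ := by
  change (√(max (n.1 x) δ))⁻¹ = _
  rw [max_eq_left (hn x)]

lemma logC_comp (x : AddCircle L) : (logC hδ).comp n.1 x = Real.log (n.1 x) := by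
  change Real.log (max (n.1 x) δ) = _
  rw [max_eq_left (hn x)]

lemma sqrtPair_mem (hmem : n ∈ sobolevPairs L ℝ) : sqrtPair hδ n ∈ sobolevPairs L ℝ := by
  refine chain_mem_sobolevPairs (f := Real.sqrt) (f' := fun x => 1 / (2 * √x)) ?_
    (fun x hx => Real.hasDerivAt_sqrt hx.ne') hδ hmem hn (fun x => rfl) fun x => ?_
  · exact fun x hx => (Real.contDiffAt_sqrt (ne_of_gt hx)).contDiffWithinAt
  · rw [ContinuousMap.smul_apply, invSqrtC_comp hn, smul_eq_mul]
    field_simp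

lemma invSqrtPair_mem (hmem : n ∈ sobolevPairs L ℝ) : invSqrtPair hδ n ∈ sobolevPairs L ℝ := by
  refine chain_mem_sobolevPairs (f := fun y => (√y)⁻¹)
    (f' := fun x => -(1 / (2 * √x)) / (√x) ^ 2) ?_
    (fun x hx => (Real.hasDerivAt_sqrt hx.ne').fun_inv (Real.sqrt_pos.2 hx).ne') hδ hmem hn
    (fun x => invSqrtC_comp hn x) fun x => ?_
  · exact fun x hx => ((Real.contDiffAt_sqrt (ne_of_gt hx)).inv
      (Real.sqrt_pos.2 hx).ne').contDiffWithinAt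
  · rw [ContinuousMap.smul_apply, ContinuousMap.pow_apply, invSqrtC_comp hn, smul_eq_mul]
    field_simp

lemma sqrtRate_mem {p : Params} {ε : ℝ} {u : Pair L ℂ} (hu : u ∈ sobolevPairs L ℂ)
    (hmem : n ∈ sobolevPairs L ℝ) : sqrtRate p ε hδ u n ∈ sobolevPairs L ℝ :=
  Submodule.smul_mem _ _ (Submodule.sub_mem _ (Submodule.smul_mem _ _ (invSqrtPair_mem hn hmem))
    (mul_mem_sobolevPairs _ (loss_mem hu) (sqrtPair_mem hn hmem)))

end Pointwise

lemma continuousOn_sqrtPair {δ : ℝ} (hδ : 0 < δ) {n : ℝ → Pair L ℝ} {s : Set ℝ}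
    (hn : ContinuousOn n s) : ContinuousOn (fun t => sqrtPair hδ (n t)) s := by
  have h1 := (ContinuousMap.continuous_postcomp (X := AddCircle L) sqrtC).comp_continuousOn hn.fst
  have h2 := (ContinuousMap.continuous_postcomp (X := AddCircle L)
    (invSqrtC hδ)).comp_continuousOn hn.fst
  exact h1.prodMk (((mulL2 _).continuous.comp_continuousOn
    (h2.const_smul (1 / 2 : ℝ))).clm_apply hn.snd)

lemma continuousOn_invSqrtPair {δ : ℝ} (hδ : 0 < δ) {n : ℝ → Pair L ℝ} {s : Set ℝ}
    (hn : ContinuousOn n s) : ContinuousOn (fun t => invSqrtPair hδ (n t)) s := by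
  have h2 := (ContinuousMap.continuous_postcomp (X := AddCircle L)
    (invSqrtC hδ)).comp_continuousOn hn.fst
  exact h2.prodMk (((mulL2 _).continuous.comp_continuousOn
    ((h2.pow 3).const_smul (-(1 / 2 : ℝ)))).clm_apply hn.snd)

section

variable {p : Params} {ε T : ℝ} {u : ℝ → Pair L ℂ} {n : ℝ → Pair L ℝ}
  (hS : IsPairSolution p ε T u n) {t : ℝ}
include hS

lemma continuousOn_sqrtRate {δ : ℝ} (hδ : 0 < δ) :
    ContinuousOn (fun t => sqrtRate p ε hδ (u t) (n t)) (Icc 0 T) :=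
  (((continuousOn_invSqrtPair hδ hS.n_cont).const_smul p.P).sub
    (Pair.continuousOn_mul _ (continuousOn_loss hS.u_cont)
      (continuousOn_sqrtPair hδ hS.n_cont))).const_smul (ε⁻¹ / 2)

/-- The reservoir equation holds in the uniform norm. -/
lemma hasDerivAt_n (ht : t ∈ Ioo 0 T) :
    HasDerivAt (fun s => (n s).1) (rate p ε (u t) (n t)).1 t := by
  refine hasDerivAt_of_functionals
    (fun q : smoothPairs L ℝ => (innerSL ℝ (toL2 q.1.1)).comp toL2)
    (fun f hf => ?_) (g := fun s => (rate p ε (u s) (n s)).1)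
    (continuousOn_rate hS.u_cont hS.n_cont).fst (fun q => ?_) (fun q t ht => ?_) ht
  · exact toL2_injective ((eq_zero_of_forall_inner_smooth hf).trans (map_zero _).symm)
  · exact ((innerSL ℝ (toL2 q.1.1)).comp toL2).continuous.comp_continuousOn hS.n_cont.fst
  · have h1 := hS.n_eq q.1 q.2 t ht
    have h2 : ∀ f : C(AddCircle L, ℝ), ((innerSL ℝ (toL2 q.1.1)).comp toL2) f =
        ∫ x, f x * q.1.1 x := by
      intro f
      change inner ℝ (toL2 q.1.1) (toL2 f) = _
      rw [real_inner_toL2_toL2, mul_comm, intC_apply]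
      rfl
    simpa only [h2] using h1

lemma hasDerivAt_n_apply (ht : t ∈ Ioo 0 T) (x : AddCircle L) :
    HasDerivAt (fun s => (n s).1 x) ((rate p ε (u t) (n t)).1 x) t :=
  (ContinuousMap.evalCLM ℝ x : C(AddCircle L, ℝ) →L[ℝ] ℝ).hasFDerivAt.comp_hasDerivAt t
    (hasDerivAt_n hS ht)

variable {δ : ℝ} {hδ : 0 < δ} (hn : ∀ t ∈ Icc 0 T, ∀ x, δ ≤ (n t).1 x) (ht : t ∈ Ioo 0 T)
include hn ht

lemma hasDerivAt_log : HasDerivAt (fun s => (logC hδ).comp (n s).1)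
    (((invSqrtC hδ).comp (n t).1) ^ 2 * (rate p ε (u t) (n t)).1) t := by
  have hc := (ContinuousMap.continuous_postcomp (X := AddCircle L)
    (logC hδ)).comp_continuousOn hS.n_cont.fst
  have hc2 := (ContinuousMap.continuous_postcomp (X := AddCircle L)
    (invSqrtC hδ)).comp_continuousOn hS.n_cont.fst
  refine hasDerivAt_of_pointwise (g := fun t => ((invSqrtC hδ).comp (n t).1) ^ 2 *
    (rate p ε (u t) (n t)).1) hc ((hc2.pow 2).mul (continuousOn_rate hS.u_cont hS.n_cont).fst)
    (fun x t ht => ?_) ht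
  have hpos := hδ.trans_le (hn t (Ioo_subset_Icc_self ht) x)
  have h1 := (hasDerivAt_n_apply hS ht x).log hpos.ne'
  rw [ContinuousMap.mul_apply, ContinuousMap.pow_apply,
    invSqrtC_comp (hn t (Ioo_subset_Icc_self ht)), inv_pow, Real.sq_sqrt hpos.le]
  convert! h1.congr_of_eventuallyEq ?_ using 1
  · rw [div_eq_inv_mul]
  · filter_upwards [Ioo_mem_nhds ht.1 ht.2] with s hs
    exact logC_comp (hn s (Ioo_subset_Icc_self hs)) x

lemma hasDerivAt_sqrt_fst : HasDerivAt (fun s => (sqrtPair hδ (n s)).1)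
    (sqrtRate p ε hδ (u t) (n t)).1 t := by
  refine hasDerivAt_of_pointwise (g := fun t => (sqrtRate p ε hδ (u t) (n t)).1)
    (continuousOn_sqrtPair hδ hS.n_cont).fst (continuousOn_sqrtRate hS hδ).fst
    (fun x t ht => ?_) ht
  have hpos := hδ.trans_le (hn t (Ioo_subset_Icc_self ht) x)
  have hsq := Real.sqrt_pos.2 hpos
  refine ((hasDerivAt_n_apply hS ht x).sqrt hpos.ne').congr_deriv ?_
  change _ = (ε⁻¹ / 2) * (p.P * (invSqrtC hδ).comp (n t).1 x - (loss p (u t)).1 x * √((n t).1 x))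
  rw [invSqrtC_comp (hn t (Ioo_subset_Icc_self ht)), loss_fst, rate_fst]
  have h2 := Real.sq_sqrt hpos.le
  set w := √((n t).1 x)
  rw [← h2]
  field_simp

/-- The derivative `∂ₓ√n` is differentiable in time with values in `L²`. -/
lemma hasDerivAt_sqrt_snd : HasDerivAt (fun s => (sqrtPair hδ (n s)).2)
    (sqrtRate p ε hδ (u t) (n t)).2 t := by
  have hc := continuousOn_sqrtPair hδ hS.n_cont
  refine hasDerivAt_of_functionals (fun q : smoothPairs L ℝ => innerSL ℝ (toL2 q.1.1))
    (fun f hf => eq_zero_of_forall_inner_smooth hf)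
    (g := fun t => (sqrtRate p ε hδ (u t) (n t)).2)
    (continuousOn_sqrtRate hS hδ).snd
    (fun q => (innerSL ℝ (toL2 q.1.1)).continuous.comp_continuousOn hc.snd) (fun q t ht => ?_) ht
  have hq := smoothPairs_le q.2
  have h1 := (-((innerSL ℝ q.1.2).comp toL2)).hasFDerivAt.comp_hasDerivAt t
    (hasDerivAt_sqrt_fst (hδ := hδ) hS hn ht)
  refine (h1.congr_of_eventuallyEq ?_).congr_deriv ?_
  · filter_upwards [Ioo_mem_nhds ht.1 ht.2] with s hs
    exact real_inner_by_parts hq (sqrtPair_mem (hn s (Ioo_subset_Icc_self hs)) (hS.n_mem s))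
  · exact (real_inner_by_parts hq (sqrtRate_mem (hn t (Ioo_subset_Icc_self ht))
      (hS.u_mem t) (hS.n_mem t))).symm

end

/-! ### The interaction energy -/

lemma real_inner_L2_eq_re (v w : L2 L ℂ) : inner ℝ v w = (∫ x, w x * star (v x)).re := by
  rw [real_inner_L2, L2.inner_def]
  rfl

/-- Multiplication by `-i/2`, which maps `∂ₓψ` to the flux of the Schrödinger equation. -/
def flux : L2 L ℂ →L[ℝ] L2 L ℂ :=
  (ContinuousLinearMap.mul ℝ ℂ (-(Complex.I / 2))).compLpL 2 volume

lemma flux_ae (v : L2 L ℂ) :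
    (flux v : AddCircle L → ℂ) =ᵐ[volume] fun x => -(Complex.I / 2) * v x :=
  (ContinuousLinearMap.mul ℝ ℂ (-(Complex.I / 2))).coeFn_compLpL v

lemma real_inner_toL2_complex (f g : C(AddCircle L, ℂ)) :
    inner ℝ (toL2 f) (toL2 g) = intC (mulC (innerSL ℝ) f g) := by
  rw [L2.inner_def, intC_apply]
  refine integral_congr_ae ?_
  filter_upwards [coeFn_toL2 f, coeFn_toL2 g] with x h1 h2
  rw [h1, h2]
  rfl

/-- The interaction energy `∫ (λn|ψ|² + (g/2)|ψ|⁴)`. -/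
def interactionEnergy (p : Params) (u : Pair L ℂ) (n : Pair L ℝ) : ℝ :=
  intC (p.lam • (n.1 * (density u).1) + (p.g / 2) • ((density u).1 * (density u).1))

/-- The divided difference in `ψ` of the interaction energy between `u` and `v`, for fixed `n`. -/
def interactionSlope (p : Params) (u v : Pair L ℂ) (n : Pair L ℝ) : Pair L ℂ :=
  Pair.mul (ContinuousLinearMap.lsmul ℝ ℝ)
    (p.lam • n + (p.g / 2) • (density u + density v)) (u + v)

lemma interactionSlope_self (p : Params) (u : Pair L ℂ) (n : Pair L ℝ) :
    interactionSlope p u u n = (2 : ℝ) • interaction p u n := by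
  have h1 : p.lam • n + (p.g / 2) • (density u + density u) = potential p u n := by
    rw [potential]; module
  rw [interactionSlope, h1, interaction, ← two_smul ℝ u]
  refine Prod.ext ?_ ?_
  · ext x
    change (potential p u n).1 x • ((2 : ℝ) • u.1 x) = (2 : ℝ) • ((potential p u n).1 x • u.1 x)
    rw [smul_comm]
  · change mulL2 _ (potential p u n).1 ((2 : ℝ) • u.2) + mulL2 _ ((2 : ℝ) • u.1) _ =
      (2 : ℝ) • (mulL2 _ (potential p u n).1 u.2 + mulL2 _ u.1 _)
    rw [map_smul, map_smul, smul_apply, smul_add]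

lemma interactionEnergy_sub (p : Params) (u v : Pair L ℂ) (n m : Pair L ℝ) :
    interactionEnergy p u n = interactionEnergy p v m +
      p.lam * intC ((n.1 - m.1) * (density u).1) +
      inner ℝ (toL2 (u.1 - v.1)) (toL2 (interactionSlope p u v m).1) := by
  rw [real_inner_toL2_complex, interactionEnergy, interactionEnergy, ← smul_eq_mul p.lam,
    ← map_smul, ← map_add, ← map_add]
  congr 1
  ext x
  change p.lam * (n.1 x * (density u).1 x) + p.g / 2 * ((density u).1 x * (density u).1 x) =
    p.lam * (m.1 x * (density v).1 x) + p.g / 2 * ((density v).1 x * (density v).1 x) +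
    p.lam * ((n.1 x - m.1 x) * (density u).1 x) +
    inner ℝ (u.1 x - v.1 x) ((p.lam * m.1 x + p.g / 2 * ((density u).1 x + (density v).1 x)) •
      (u.1 x + v.1 x))
  have h : inner ℝ (u.1 x - v.1 x) (u.1 x + v.1 x) = ‖u.1 x‖ ^ 2 - ‖v.1 x‖ ^ 2 := by
    rw [inner_add_right, inner_sub_left, inner_sub_left, real_inner_self_eq_norm_sq,
      real_inner_self_eq_norm_sq, real_inner_comm (u.1 x) (v.1 x)]
    ring
  rw [real_inner_smul_right, h, density_fst, density_fst]
  ring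

section

variable {p : Params} {ε T : ℝ} {u : ℝ → Pair L ℂ} {n : ℝ → Pair L ℝ}
  (hS : IsPairSolution p ε T u n)
include hS

lemma continuousOn_flux : ContinuousOn (fun t => flux (u t).2) (Icc 0 T) :=
  flux.continuous.comp_continuousOn hS.u_cont.snd

lemma continuousOn_toL2_source :
    ContinuousOn (fun t => toL2 (source p (u t) (n t)).1) (Icc 0 T) :=
  toL2.continuous.comp_continuousOn (continuousOn_source hS.u_cont hS.n_cont).fst

/-- The Schrödinger equation tested against a smooth function, in real form. -/
lemma hasDerivAt_inner_smooth {q : Pair L ℂ} (hq : q ∈ smoothPairs L ℂ) {t : ℝ}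
    (ht : t ∈ Ioo 0 T) : HasDerivAt (fun s => inner ℝ (toL2 q.1) (toL2 (u s).1))
      (inner ℝ (toL2 q.1) (toL2 (source p (u t) (n t)).1) + inner ℝ q.2 (flux (u t).2)) t := by
  have h1 := Complex.reCLM.hasFDerivAt.comp_hasDerivAt t
    (hS.u_eq _ (comp_mem_smoothPairs (starL' ℝ : ℂ ≃L[ℝ] ℂ).toContinuousLinearMap hq) t ht)
  convert! h1 using 1
  · ext s
    rw [real_inner_L2_eq_re]
    change _ = (∫ x, (u s).1 x * star (q.1 x)).re
    congr 1
    refine integral_congr_ae ?_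
    filter_upwards [coeFn_toL2 q.1, coeFn_toL2 (u s).1] with x h2 h3
    rw [h2, h3]
  · rw [real_inner_L2_eq_re, real_inner_L2_eq_re, ← Complex.add_re, ← integral_add]
    · change _ = Complex.re _
      congr 1
      refine integral_congr_ae ?_
      filter_upwards [coeFn_toL2 q.1, coeFn_toL2 (source p (u t) (n t)).1, flux_ae (u t).2,
        (starL' ℝ : ℂ ≃L[ℝ] ℂ).toContinuousLinearMap.coeFn_compLpL (p := 2) (μ := volume) q.2]
        with x h2 h3 h4 h5
      rw [h2, h3, h4, h5]
      change _ = -(Complex.I / 2) * (u t).2 x * star (q.2 x) +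
        (source p (u t) (n t)).1 x * star (q.1 x)
      ring
    · exact L2.integrable_inner (𝕜 := ℂ) (toL2 q.1) (toL2 (source p (u t) (n t)).1)
    · exact L2.integrable_inner (𝕜 := ℂ) q.2 (flux (u t).2)

/-- The Schrödinger equation integrated in time, tested against an element of `H¹`. -/
lemma inner_increment {q : Pair L ℂ} (hq : q ∈ sobolevPairs L ℂ) {t : ℝ} (ht : t ∈ Icc 0 T) :
    inner ℝ (toL2 q.1) (toL2 (u t).1) - inner ℝ (toL2 q.1) (toL2 (u 0).1) =
      inner ℝ (toL2 q.1) (∫ s in (0 : ℝ)..t, toL2 (source p (u s) (n s)).1) +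
        inner ℝ q.2 (∫ s in (0 : ℝ)..t, flux (u s).2) := by
  have hsub : Icc 0 t ⊆ Icc 0 T := Icc_subset_Icc_right ht.2
  have h1 : IntervalIntegrable (fun s => toL2 (source p (u s) (n s)).1) volume 0 t :=
    ((continuousOn_toL2_source hS).mono hsub).intervalIntegrable_of_Icc ht.1
  have h2 : IntervalIntegrable (fun s => flux (u s).2) volume 0 t :=
    ((continuousOn_flux hS).mono hsub).intervalIntegrable_of_Icc ht.1
  refine sobolevPairs_induction (P := fun q : Pair L ℂ =>
    inner ℝ (toL2 q.1) (toL2 (u t).1) - inner ℝ (toL2 q.1) (toL2 (u 0).1) =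
      inner ℝ (toL2 q.1) (∫ s in (0 : ℝ)..t, toL2 (source p (u s) (n s)).1) +
        inner ℝ q.2 (∫ s in (0 : ℝ)..t, flux (u s).2))
    (isClosed_eq (by fun_prop) (by fun_prop)) (fun q hq => ?_) hq
  have h3 := (innerSL ℝ (toL2 q.1)).intervalIntegral_comp_comm h1
  have h4 := (innerSL ℝ q.2).intervalIntegral_comp_comm h2
  simp only [innerSL_apply_apply] at h3 h4
  have hc : ContinuousOn (fun s => inner ℝ (toL2 q.1) (toL2 (u s).1)) (Icc 0 T) :=
    continuousOn_const.inner (toL2.continuous.comp_continuousOn hS.u_cont.fst)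
  have hc1 : ContinuousOn (fun s => inner ℝ (toL2 q.1) (toL2 (source p (u s) (n s)).1))
    (Icc 0 T) := continuousOn_const.inner (continuousOn_toL2_source hS)
  have hc2 : ContinuousOn (fun s => inner ℝ q.2 (flux (u s).2)) (Icc 0 T) :=
    continuousOn_const.inner (continuousOn_flux hS)
  have hi1 := (hc1.mono hsub).intervalIntegrable_of_Icc (μ := volume) ht.1
  have hi2 := (hc2.mono hsub).intervalIntegrable_of_Icc (μ := volume) ht.1
  rw [← h3, ← h4, ← intervalIntegral.integral_add hi1 hi2]
  exact (intervalIntegral.integral_eq_sub_of_hasDerivAt_of_le ht.1 (hc.mono hsub)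
    (fun s hs => hasDerivAt_inner_smooth hS hq ⟨hs.1, hs.2.trans_le ht.2⟩) (hi1.add hi2)).symm

/-- Although `∂ₜψ` is only a distribution of order one, a difference `ψ(s) - ψ(t)` can be tested
against a curve in `H¹` and the result is differentiable at `t`. -/
lemma hasDerivAt_inner_increment {q : ℝ → Pair L ℂ} (hq : ∀ s, q s ∈ sobolevPairs L ℂ) {t : ℝ}
    (ht : t ∈ Ioo 0 T) (hqc : ContinuousAt q t) :
    HasDerivAt (fun s => inner ℝ (toL2 ((u s).1 - (u t).1)) (toL2 (q s).1))
      (inner ℝ (toL2 (source p (u t) (n t)).1) (toL2 (q t).1) +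
        inner ℝ (flux (u t).2) (q t).2) t := by
  have h1 := (hasDerivAt_integral_of_continuousOn (continuousOn_toL2_source hS) ht).sub_const
    (∫ s in (0 : ℝ)..t, toL2 (source p (u s) (n s)).1)
  have h2 := (hasDerivAt_integral_of_continuousOn (continuousOn_flux hS) ht).sub_const
    (∫ s in (0 : ℝ)..t, flux (u s).2)
  have h3 := (hasDerivAt_bilin_of_eq_zero (innerSL ℝ) h1 (sub_self _)
    (toL2.continuous.continuousAt.comp hqc.fst)).add
    (hasDerivAt_bilin_of_eq_zero (innerSL ℝ) h2 (sub_self _) hqc.snd)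
  refine h3.congr_of_eventuallyEq ?_
  filter_upwards [Ioo_mem_nhds ht.1 ht.2] with s hs
  have h4 := inner_increment hS (hq s) (Ioo_subset_Icc_self hs)
  have h5 := inner_increment hS (hq s) (Ioo_subset_Icc_self ht)
  change _ = inner ℝ (_ - _) (toL2 (q s).1) + inner ℝ (_ - _) (q s).2
  rw [real_inner_comm, real_inner_comm (toL2 (q s).1), real_inner_comm (q s).2, map_sub,
    inner_sub_right, inner_sub_right, inner_sub_right]
  linarith

lemma hasDerivAt_interactionEnergy {t : ℝ} (ht : t ∈ Ioo 0 T) :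
    HasDerivAt (fun s => interactionEnergy p (u s) (n s))
      (p.lam * intC ((rate p ε (u t) (n t)).1 * (density (u t)).1) +
        (inner ℝ (toL2 (source p (u t) (n t)).1) (toL2 ((2 : ℝ) • interaction p (u t) (n t)).1) +
        inner ℝ (flux (u t).2) ((2 : ℝ) • interaction p (u t) (n t)).2)) t := by
  have hnh := Icc_mem_nhds ht.1 ht.2
  have hρ : ContinuousOn (fun s => density (u s)) (Icc 0 T) := continuousOn_density hS.u_cont
  have hq : ContinuousOn (fun s => interactionSlope p (u s) (u t) (n t)) (Icc 0 T) :=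
    Pair.continuousOn_mul _ (continuousOn_const.add
      ((hρ.add continuousOn_const).const_smul (p.g / 2))) (hS.u_cont.add continuousOn_const)
  have h1 := hasDerivAt_inner_increment hS (q := fun s => interactionSlope p (u s) (u t) (n t))
    (fun s => mul_mem_sobolevPairs _ (Submodule.add_mem _ (Submodule.smul_mem _ _ (hS.n_mem t))
      (Submodule.smul_mem _ _ (Submodule.add_mem _ (density_mem (hS.u_mem s))
        (density_mem (hS.u_mem t))))) (Submodule.add_mem _ (hS.u_mem s) (hS.u_mem t)))
    ht (hq.continuousAt hnh)
  have h2 := hasDerivAt_bilin_of_eq_zero (ContinuousLinearMap.mul ℝ C(AddCircle L, ℝ))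
    ((hasDerivAt_n hS ht).sub_const (n t).1) (sub_self _) (hρ.continuousAt hnh).fst
  have h3 := ((intC (L := L)).hasFDerivAt.comp_hasDerivAt t h2).const_mul p.lam
  have h4 := (h3.add h1).const_add (interactionEnergy p (u t) (n t))
  rw [interactionSlope_self] at h4
  refine h4.congr_of_eventuallyEq (Eventually.of_forall fun s => ?_)
  refine (interactionEnergy_sub p (u s) (u t) (n s) (n t)).trans ?_
  rw [add_assoc]
  rfl

end

/-! ### The modified energy along a solution -/

/-- Gronwall's inequality. -/
lemma le_exp_mul_of_hasDerivAt_le {y y' : ℝ → ℝ} {C T : ℝ} (hc : ContinuousOn y (Icc 0 T))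
    (hd : ∀ t ∈ Ioo 0 T, HasDerivAt y (y' t) t) (hle : ∀ t ∈ Ioo 0 T, y' t ≤ C * y t) {t : ℝ}
    (ht : t ∈ Icc 0 T) : y t ≤ Real.exp (C * t) * y 0 := by
  have hE : ∀ s, HasDerivAt (fun s => Real.exp (-C * s)) (Real.exp (-C * s) * -C) s := fun s => by
    simpa using ((hasDerivAt_id s).const_mul (-C)).exp
  have hanti : AntitoneOn (fun s => Real.exp (-C * s) * y s) (Icc 0 T) := by
    refine antitoneOn_of_hasDerivWithinAt_nonpos (convex_Icc 0 T)
      (f' := fun s => Real.exp (-C * s) * -C * y s + Real.exp (-C * s) * y' s)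
      ((by fun_prop : Continuous fun s : ℝ => Real.exp (-C * s)).continuousOn.mul hc)
      (fun s hs => ?_) (fun s hs => ?_)
    · rw [interior_Icc] at hs
      exact ((hE s).mul (hd s hs)).hasDerivWithinAt
    · rw [interior_Icc] at hs
      nlinarith [hle s hs, Real.exp_pos (-C * s)]
  have h1 := hanti (left_mem_Icc.2 (ht.1.trans ht.2)) ht ht.1
  simp only [mul_zero, Real.exp_zero, one_mul] at h1
  have h2 := mul_le_mul_of_nonneg_left h1 (Real.exp_pos (C * t)).le
  rwa [← mul_assoc, ← Real.exp_add, neg_mul, add_neg_cancel, Real.exp_zero, one_mul] at h2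

/-- The functional `F` in terms of pairs. -/
def pairF (p : Params) (ε : ℝ) {δ : ℝ} (hδ : 0 < δ) (u : Pair L ℂ) (n : Pair L ℝ) : ℝ :=
  1 / 2 * ‖u.2‖ ^ 2 + interactionEnergy p u n + ε / 2 * ‖(sqrtPair hδ n).2‖ ^ 2
    - p.lam * p.P / p.R * intC ((logC hδ).comp n.1) + p.β * p.lam / p.R * intC n.1

/-- The integrand of the dissipation identity for `F`: the terms with `∂ₓ` of the interaction
cancel because the Hamiltonian part conserves the energy, and the terms with `∂ₓ|ψ|²` cancel
against the ones produced by `∂ₓ√n`. All other terms apart from the gain have a sign. -/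
lemma dissipation_le (p : Params) {ε M : ℝ} (hε : 0 < ε) {U V H : ℂ} {n W w z Z κ m a r : ℝ}
    (hn : 0 < n) (hM : n ≤ M) (hw : w = √n) (hz : z = (√n)⁻¹) (hZ : Z = 1 / 2 * z * W)
    (hκ : κ = p.lam * n + p.g * ‖U‖ ^ 2) (hm : m = p.R * n - p.α) (ha : a = p.R * ‖U‖ ^ 2 + p.β)
    (hr : r = ε⁻¹ * (p.P - a * n)) :
    inner ℝ V (-Complex.I * H + (1 / 2 : ℝ) • (m • V + (p.R * W) • U)) +
      inner ℝ (-Complex.I * (κ • U) + (1 / 2 : ℝ) • (m • U)) ((2 : ℝ) • (κ • U)) +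
      inner ℝ (-(Complex.I / 2) * V) ((2 : ℝ) • H) +
      ε * (Z * (ε⁻¹ / 2 * (p.P * (-(1 / 2) * z ^ 3 * W) -
        (a * Z + p.R * (2 * inner ℝ U V) * w)))) +
      (p.lam * (r * ‖U‖ ^ 2) - p.lam * p.P / p.R * (z ^ 2 * r) + p.β * p.lam / p.R * r) ≤
    2 * p.R * M * (1 / 2 * ‖V‖ ^ 2 + (p.lam * (n * ‖U‖ ^ 2) +
      p.g / 2 * (‖U‖ ^ 2 * ‖U‖ ^ 2))) := by
  have hsq := Real.sqrt_pos.2 hn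
  have hwpos : 0 < w := hw ▸ hsq
  have hwz : w * z = 1 := by rw [hw, hz]; exact mul_inv_cancel₀ hsq.ne'
  have hw2 : w ^ 2 = n := by rw [hw, Real.sq_sqrt hn.le]
  have hW : W = 2 * w * Z := by rw [hZ]; linear_combination (-W) * hwz
  have hz2 : z ^ 2 * n = 1 := by rw [← hw2]; linear_combination (w * z + 1) * hwz
  -- The terms containing `H` cancel: this is conservation of energy.
  have h1 : inner ℝ V (-Complex.I * H + (1 / 2 : ℝ) • (m • V + (p.R * W) • U)) +
      inner ℝ (-Complex.I * (κ • U) + (1 / 2 : ℝ) • (m • U)) ((2 : ℝ) • (κ • U)) +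
      inner ℝ (-(Complex.I / 2) * V) ((2 : ℝ) • H) =
      m * (1 / 2 * ‖V‖ ^ 2 + κ * ‖U‖ ^ 2) + 1 / 2 * p.R * W * inner ℝ U V := by
    rw [← Complex.normSq_eq_norm_sq, ← Complex.normSq_eq_norm_sq]
    simp only [Complex.inner, Complex.normSq_apply, Complex.real_smul, Complex.mul_re,
      Complex.mul_im, Complex.add_re, Complex.add_im, Complex.conj_re, Complex.conj_im,
      Complex.neg_re, Complex.neg_im, Complex.I_re, Complex.I_im, Complex.ofReal_re,
      Complex.ofReal_im, Complex.div_ofNat_re, Complex.div_ofNat_im]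
    ring
  have h2 : ε * (Z * (ε⁻¹ / 2 * (p.P * (-(1 / 2) * z ^ 3 * W) -
        (a * Z + p.R * (2 * inner ℝ U V) * w)))) =
      -(1 / 2) * (p.P * z ^ 2 + a) * Z ^ 2 - 1 / 2 * p.R * W * inner ℝ U V := by
    have h3 : ε * ε⁻¹ = 1 := mul_inv_cancel₀ hε.ne'
    have h4 : z ^ 3 * W = 2 * z ^ 2 * Z := by rw [hW]; linear_combination (2 * z ^ 2 * Z) * hwz
    have h5 : ε * (Z * (ε⁻¹ / 2 * (p.P * (-(1 / 2) * z ^ 3 * W) -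
        (a * Z + p.R * (2 * inner ℝ U V) * w)))) =
        ε * ε⁻¹ * (Z / 2 * (p.P * (-(1 / 2) * (z ^ 3 * W)) -
        (a * Z + p.R * (2 * inner ℝ U V) * w))) := by ring
    rw [h5, h3, h4, hW]
    ring
  have h6 : p.lam * (r * ‖U‖ ^ 2) - p.lam * p.P / p.R * (z ^ 2 * r) + p.β * p.lam / p.R * r =
      -(p.lam / p.R * ε⁻¹ * z ^ 2 * (p.P - a * n) ^ 2) := by
    have hR := p.R_pos.ne'
    rw [hr, ha]
    field_simp
    linear_combination (-p.lam * (p.R * ‖U‖ ^ 2 + p.β) * (p.P - n * (p.R * ‖U‖ ^ 2 + p.β))) * hz2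
  rw [h1, h2, h6]
  have hg := p.g_pos
  have hlam := p.lam_pos
  have hα := p.α_pos
  have hβ := p.β_pos
  have hR := p.R_pos
  have hP := p.P_pos
  have hapos : 0 < a := by rw [ha]; positivity
  have h7 : 0 ≤ p.lam / p.R * ε⁻¹ * z ^ 2 * (p.P - a * n) ^ 2 := by positivity
  have h8 : 0 ≤ (p.P * z ^ 2 + a) * Z ^ 2 := by positivity
  have h9 : m ≤ p.R * M := by rw [hm]; nlinarith
  have h10 : 0 ≤ p.R * M := by have := hn.le.trans hM; positivity
  have h11 : m * (1 / 2 * ‖V‖ ^ 2 + κ * ‖U‖ ^ 2) ≤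
      p.R * M * (1 / 2 * ‖V‖ ^ 2 + κ * ‖U‖ ^ 2) := by
    refine mul_le_mul_of_nonneg_right h9 ?_
    rw [hκ]; positivity
  have h12 : 1 / 2 * ‖V‖ ^ 2 + κ * ‖U‖ ^ 2 ≤ 2 * (1 / 2 * ‖V‖ ^ 2 + (p.lam * (n * ‖U‖ ^ 2) +
      p.g / 2 * (‖U‖ ^ 2 * ‖U‖ ^ 2))) := by
    have h13 : 0 ≤ 1 / 2 * ‖V‖ ^ 2 + p.lam * n * ‖U‖ ^ 2 := by positivity
    rw [hκ]; linarith
  have h14 := h11.trans (mul_le_mul_of_nonneg_left h12 h10)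
  rw [← mul_assoc, mul_comm (p.R * M) 2, ← mul_assoc] at h14
  refine le_trans ?_ h14
  linarith

lemma integral_norm_sq (v : L2 L ℂ) : ‖v‖ ^ 2 = ∫ x, ‖v x‖ ^ 2 := by
  rw [← real_inner_self_eq_norm_sq, L2.inner_def]
  simp only [real_inner_self_eq_norm_sq]

lemma integrable_continuous (f : C(AddCircle L, ℝ)) : Integrable f volume :=
  f.continuous.integrable_of_hasCompactSupport (HasCompactSupport.of_compactSpace _)

lemma gain_fst (p : Params) (r : Pair L ℝ) (x : AddCircle L) :
    (gain p r).1 x = p.R * r.1 x - p.α := rfl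

lemma source_snd_ae (p : Params) (u : Pair L ℂ) (n : Pair L ℝ) :
    ((source p u n).2 : AddCircle L → ℂ) =ᵐ[volume] fun x =>
      -Complex.I * (interaction p u n).2 x +
        (1 / 2 : ℝ) • ((p.R * n.1 x - p.α) • u.2 x + (p.R * n.2 x) • u.1 x) := by
  have h0 : (gain p n).2 = p.R • n.2 := by
    change p.R • n.2 - 0 = _
    rw [sub_zero]
  filter_upwards [Lp.coeFn_add (Pair.map (ContinuousLinearMap.mul ℝ ℂ (-Complex.I))
      (interaction p u n)).2 ((1 / 2 : ℝ) •
        (Pair.mul (ContinuousLinearMap.lsmul ℝ ℝ) (gain p n) u).2),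
    Pair.map_snd_ae (ContinuousLinearMap.mul ℝ ℂ (-Complex.I)) (interaction p u n),
    Lp.coeFn_smul (1 / 2 : ℝ) (Pair.mul (ContinuousLinearMap.lsmul ℝ ℝ) (gain p n) u).2,
    Pair.mul_snd_ae (ContinuousLinearMap.lsmul ℝ ℝ) (gain p n) u,
    Lp.coeFn_smul p.R n.2] with x h1 h2 h3 h4 h5
  refine h1.trans ?_
  rw [Pi.add_apply, h2, h3, Pi.smul_apply, h4, gain_fst, h0, h5]
  rfl

lemma loss_snd_ae (p : Params) (u : Pair L ℂ) : ((loss p u).2 : AddCircle L → ℝ) =ᵐ[volume]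
    fun x => p.R * (2 * inner ℝ (u.1 x) (u.2 x)) := by
  have h0 : (loss p u).2 = p.R • (density u).2 := by
    change p.R • (density u).2 + 0 = _
    rw [add_zero]
  filter_upwards [Lp.coeFn_smul p.R (density u).2, density_snd_ae u] with x h1 h2
  rw [h0, h1, Pi.smul_apply, h2, smul_eq_mul]

section

variable {δ : ℝ} {hδ : 0 < δ} {n : Pair L ℝ} (hn : ∀ x, δ ≤ n.1 x)
include hn

lemma sqrtPair_snd_ae : ((sqrtPair hδ n).2 : AddCircle L → ℝ) =ᵐ[volume]
    fun x => 1 / 2 * (√(n.1 x))⁻¹ * n.2 x := by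
  filter_upwards [coeFn_mulL2 (ContinuousLinearMap.mul ℝ ℝ)
    ((1 / 2 : ℝ) • (invSqrtC hδ).comp n.1) n.2] with x h1
  refine h1.trans ?_
  rw [ContinuousLinearMap.mul_apply', ContinuousMap.smul_apply, invSqrtC_comp hn, smul_eq_mul]

lemma invSqrtPair_snd_ae : ((invSqrtPair hδ n).2 : AddCircle L → ℝ) =ᵐ[volume]
    fun x => -(1 / 2) * (√(n.1 x))⁻¹ ^ 3 * n.2 x := by
  filter_upwards [coeFn_mulL2 (ContinuousLinearMap.mul ℝ ℝ)
    (-(1 / 2 : ℝ) • ((invSqrtC hδ).comp n.1) ^ 3) n.2] with x h1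
  refine h1.trans ?_
  rw [ContinuousLinearMap.mul_apply', ContinuousMap.smul_apply, ContinuousMap.pow_apply,
    invSqrtC_comp hn, smul_eq_mul]

lemma sqrtRate_snd_ae (p : Params) (ε : ℝ) (u : Pair L ℂ) :
    ((sqrtRate p ε hδ u n).2 : AddCircle L → ℝ) =ᵐ[volume] fun x =>
      ε⁻¹ / 2 * (p.P * (-(1 / 2) * (√(n.1 x))⁻¹ ^ 3 * n.2 x) -
        ((p.R * ‖u.1 x‖ ^ 2 + p.β) * (sqrtPair hδ n).2 x +
          p.R * (2 * inner ℝ (u.1 x) (u.2 x)) * √(n.1 x))) := by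
  filter_upwards [Lp.coeFn_smul (ε⁻¹ / 2) (p.P • (invSqrtPair hδ n).2 -
      (Pair.mul (ContinuousLinearMap.mul ℝ ℝ) (loss p u) (sqrtPair hδ n)).2),
    Lp.coeFn_sub (p.P • (invSqrtPair hδ n).2)
      (Pair.mul (ContinuousLinearMap.mul ℝ ℝ) (loss p u) (sqrtPair hδ n)).2,
    Lp.coeFn_smul p.P (invSqrtPair hδ n).2, invSqrtPair_snd_ae (hδ := hδ) hn,
    Pair.mul_snd_ae (ContinuousLinearMap.mul ℝ ℝ) (loss p u) (sqrtPair hδ n),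
    loss_snd_ae p u] with x h1 h2 h3 h4 h5 h6
  refine h1.trans ?_
  rw [Pi.smul_apply, h2, Pi.sub_apply, h3, Pi.smul_apply, h4, h5, h6, ← loss_fst]
  rfl

end

/-- The time derivative of `F` along a solution. -/
def pairFRate (p : Params) (ε : ℝ) {δ : ℝ} (hδ : 0 < δ) (u : Pair L ℂ) (n : Pair L ℝ) : ℝ :=
  inner ℝ u.2 (source p u n).2 +
    (p.lam * intC ((rate p ε u n).1 * (density u).1) +
      (inner ℝ (toL2 (source p u n).1) (toL2 ((2 : ℝ) • interaction p u n).1) +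
      inner ℝ (flux u.2) ((2 : ℝ) • interaction p u n).2)) +
    ε * inner ℝ (sqrtPair hδ n).2 (sqrtRate p ε hδ u n).2
    - p.lam * p.P / p.R * intC (((invSqrtC hδ).comp n.1) ^ 2 * (rate p ε u n).1)
    + p.β * p.lam / p.R * intC (rate p ε u n).1

/-- The integrated form of `dissipation_le`. -/
lemma pairFRate_le (p : Params) {ε : ℝ} (hε : 0 < ε) {δ : ℝ} (hδ : 0 < δ) {M : ℝ} (u : Pair L ℂ)
    {n : Pair L ℝ} (hn : ∀ x, δ ≤ n.1 x) (hM : ∀ x, n.1 x ≤ M) :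
    pairFRate p ε hδ u n ≤ 2 * p.R * M * (1 / 2 * ‖u.2‖ ^ 2 + interactionEnergy p u n) := by
  have e1 : inner ℝ u.2 (source p u n).2 = ∫ x, inner ℝ (u.2 x) ((source p u n).2 x) :=
    L2.inner_def _ _
  have i1 := L2.integrable_inner (𝕜 := ℝ) u.2 (source p u n).2
  have e2 : inner ℝ (toL2 (source p u n).1) (toL2 ((2 : ℝ) • interaction p u n).1) =
    ∫ x, inner ℝ (toL2 (source p u n).1 x) (toL2 ((2 : ℝ) • interaction p u n).1 x) :=
    L2.inner_def _ _
  have i2 := L2.integrable_inner (𝕜 := ℝ) (toL2 (source p u n).1)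
    (toL2 ((2 : ℝ) • interaction p u n).1)
  have e3 : inner ℝ (flux u.2) ((2 : ℝ) • interaction p u n).2 =
    ∫ x, inner ℝ (flux u.2 x) (((2 : ℝ) • interaction p u n).2 x) := L2.inner_def _ _
  have i3 := L2.integrable_inner (𝕜 := ℝ) (flux u.2) ((2 : ℝ) • interaction p u n).2
  have e4 : ε * inner ℝ (sqrtPair hδ n).2 (sqrtRate p ε hδ u n).2 =
    ∫ x, ε * inner ℝ ((sqrtPair hδ n).2 x) ((sqrtRate p ε hδ u n).2 x) := by
    rw [integral_const_mul]; congr 1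
  have i4 := (L2.integrable_inner (𝕜 := ℝ) (sqrtPair hδ n).2 (sqrtRate p ε hδ u n).2).const_mul ε
  let f5 : C(AddCircle L, ℝ) := p.lam • ((rate p ε u n).1 * (density u).1) -
    (p.lam * p.P / p.R) • (((invSqrtC hδ).comp n.1) ^ 2 * (rate p ε u n).1) +
    (p.β * p.lam / p.R) • (rate p ε u n).1
  have e5 : p.lam * intC ((rate p ε u n).1 * (density u).1)
      - p.lam * p.P / p.R * intC (((invSqrtC hδ).comp n.1) ^ 2 * (rate p ε u n).1)
      + p.β * p.lam / p.R * intC (rate p ε u n).1 = ∫ x, f5 x := by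
    rw [← intC_apply]
    simp only [f5, map_add, map_sub, map_smul, smul_eq_mul]
  have i5 := integrable_continuous f5
  let f6 : C(AddCircle L, ℝ) :=
    p.lam • (n.1 * (density u).1) + (p.g / 2) • ((density u).1 * (density u).1)
  have e6 : interactionEnergy p u n = ∫ x, f6 x := intC_apply _
  have i6 := integrable_continuous f6
  have i7 : Integrable (fun x => ‖u.2 x‖ ^ 2) volume := by
    simpa only [real_inner_self_eq_norm_sq] using L2.integrable_inner (𝕜 := ℝ) u.2 u.2
  have e7 : 2 * p.R * M * (1 / 2 * ‖u.2‖ ^ 2 + interactionEnergy p u n) =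
      ∫ x, 2 * p.R * M * (1 / 2 * ‖u.2 x‖ ^ 2 + f6 x) := by
    rw [integral_const_mul, integral_add (i7.const_mul _) i6, integral_const_mul, ← e6,
      integral_norm_sq]
  have i12 : Integrable (fun x => inner ℝ (u.2 x) ((source p u n).2 x) +
      inner ℝ (toL2 (source p u n).1 x) (toL2 ((2 : ℝ) • interaction p u n).1 x)) volume :=
    i1.add i2
  have i13 : Integrable (fun x => inner ℝ (u.2 x) ((source p u n).2 x) +
      inner ℝ (toL2 (source p u n).1 x) (toL2 ((2 : ℝ) • interaction p u n).1 x) +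
      inner ℝ (flux u.2 x) (((2 : ℝ) • interaction p u n).2 x)) volume := i12.add i3
  have i14 : Integrable (fun x => inner ℝ (u.2 x) ((source p u n).2 x) +
      inner ℝ (toL2 (source p u n).1 x) (toL2 ((2 : ℝ) • interaction p u n).1 x) +
      inner ℝ (flux u.2 x) (((2 : ℝ) • interaction p u n).2 x) +
      ε * inner ℝ ((sqrtPair hδ n).2 x) ((sqrtRate p ε hδ u n).2 x)) volume := i13.add i4
  have e8 : pairFRate p ε hδ u n = ∫ x, (inner ℝ (u.2 x) ((source p u n).2 x) +
      inner ℝ (toL2 (source p u n).1 x) (toL2 ((2 : ℝ) • interaction p u n).1 x) +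
      inner ℝ (flux u.2 x) (((2 : ℝ) • interaction p u n).2 x) +
      ε * inner ℝ ((sqrtPair hδ n).2 x) ((sqrtRate p ε hδ u n).2 x) + f5 x) := by
    rw [integral_add i14 i5, integral_add i13 i4, integral_add i12 i3, integral_add i1 i2,
      ← e1, ← e2, ← e3, ← e4, ← e5, pairFRate]
    ring
  rw [e7, e8]
  refine integral_mono_ae (i14.add i5)
    (((i7.const_mul _).add i6).const_mul _) ?_
  filter_upwards [source_snd_ae p u n, coeFn_toL2 (source p u n).1,
    coeFn_toL2 ((2 : ℝ) • interaction p u n).1, flux_ae u.2,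
    Lp.coeFn_smul (2 : ℝ) (interaction p u n).2, sqrtPair_snd_ae (hδ := hδ) hn,
    sqrtRate_snd_ae (hδ := hδ) hn p ε u] with x h1 h2 h3 h4 h5 h6 h7
  have h5' : ((2 : ℝ) • interaction p u n).2 x = (2 : ℝ) • (interaction p u n).2 x := h5
  have h3' : toL2 ((2 : ℝ) • interaction p u n).1 x =
      (2 : ℝ) • ((p.lam * n.1 x + p.g * ‖u.1 x‖ ^ 2) • u.1 x) := by
    rw [h3, ← interaction_fst]; rfl
  have h8 : f5 x = p.lam * ((rate p ε u n).1 x * ‖u.1 x‖ ^ 2) -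
      p.lam * p.P / p.R * ((√(n.1 x))⁻¹ ^ 2 * (rate p ε u n).1 x) +
      p.β * p.lam / p.R * (rate p ε u n).1 x := by
    rw [← invSqrtC_comp (hδ := hδ) hn, ← density_fst]; rfl
  have h9 : f6 x = p.lam * (n.1 x * ‖u.1 x‖ ^ 2) +
      p.g / 2 * (‖u.1 x‖ ^ 2 * ‖u.1 x‖ ^ 2) := by
    rw [← density_fst]; rfl
  have h10 : inner ℝ ((sqrtPair hδ n).2 x) ((sqrtRate p ε hδ u n).2 x) =
      (sqrtPair hδ n).2 x * (sqrtRate p ε hδ u n).2 x := mul_comm _ _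
  rw [h1, h2, h3', h4, h5', h8, h9, h10, h7, source_fst, interaction_fst]
  exact dissipation_le p hε (hδ.trans_le (hn x)) (hM x) rfl rfl h6 rfl rfl rfl (rate_fst p ε u n x)

section

variable {p : Params} {ε T : ℝ} {u : ℝ → Pair L ℂ} {n : ℝ → Pair L ℝ}
  (hS : IsPairSolution p ε T u n)
include hS

/-- The reservoir density stays below `max (sup n(0)) (P/β)`. -/
lemma n_le (hε : 0 < ε) (hpos : ∀ t ∈ Icc 0 T, ∀ x, 0 < (n t).1 x) {M : ℝ} (hM : p.P / p.β ≤ M)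
    (h0 : ∀ x, (n 0).1 x ≤ M) {t : ℝ} (ht : t ∈ Icc 0 T) (x : AddCircle L) : (n t).1 x ≤ M := by
  have h1 := le_exp_mul_of_hasDerivAt_le (y := fun s => (n s).1 x - M)
    (y' := fun s => (rate p ε (u s) (n s)).1 x) (C := -(ε⁻¹ * p.β)) (T := T)
    (((ContinuousMap.evalCLM ℝ x : C(AddCircle L, ℝ) →L[ℝ] ℝ).continuous.comp_continuousOn
      hS.n_cont.fst).sub continuousOn_const)
    (fun s hs => (hasDerivAt_n_apply hS hs x).sub_const M) (fun s hs => ?_) ht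
  · have h2 : Real.exp (-(ε⁻¹ * p.β) * t) * ((n 0).1 x - M) ≤ 0 :=
      mul_nonpos_of_nonneg_of_nonpos (Real.exp_pos _).le (by linarith [h0 x])
    linarith
  · rw [rate_fst]
    have h3 : p.P ≤ M * p.β := (div_le_iff₀ p.β_pos).1 hM
    have h4 := hpos s (Ioo_subset_Icc_self hs) x
    have h5 : 0 ≤ p.R * ‖(u s).1 x‖ ^ 2 * (n s).1 x := by have := p.R_pos; positivity
    have h6 : 0 < ε⁻¹ := inv_pos.2 hε
    have h7 : ε⁻¹ * (p.P - (p.R * ‖(u s).1 x‖ ^ 2 + p.β) * (n s).1 x) ≤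
        ε⁻¹ * (-p.β * ((n s).1 x - M)) := mul_le_mul_of_nonneg_left (by linarith) h6.le
    linarith

/-- On compact time intervals `n` is bounded below by a positive constant. -/
lemma exists_lower_bound (hT : 0 ≤ T) (hpos : ∀ t ∈ Icc 0 T, ∀ x, 0 < (n t).1 x) :
    ∃ δ, 0 < δ ∧ ∀ t ∈ Icc 0 T, ∀ x, δ ≤ (n t).1 x := by
  have hc : ContinuousOn (fun z : ℝ × AddCircle L => (n z.1).1 z.2) (Icc 0 T ×ˢ univ) := by
    have h1 : ContinuousOn (fun z : ℝ × AddCircle L => (n z.1).1) (Icc 0 T ×ˢ univ) :=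
      hS.n_cont.fst.comp continuousOn_fst fun z hz => hz.1
    have h2 : Continuous fun y : C(AddCircle L, ℝ) × AddCircle L => y.1 y.2 := by fun_prop
    exact h2.comp_continuousOn (h1.prodMk continuousOn_snd)
  obtain ⟨z, hz, hmin⟩ := (isCompact_Icc.prod isCompact_univ).exists_isMinOn
    ⟨((0 : ℝ), (0 : AddCircle L)), left_mem_Icc.2 hT, mem_univ _⟩ hc
  exact ⟨(n z.1).1 z.2, hpos _ hz.1 _, fun t ht x => isMinOn_iff.1 hmin (t, x) ⟨ht, mem_univ _⟩⟩

variable {δ : ℝ} {hδ : 0 < δ}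

lemma continuousOn_pairF : ContinuousOn (fun t => pairF p ε hδ (u t) (n t)) (Icc 0 T) := by
  have hρ := (continuousOn_density hS.u_cont).fst
  have hI : ContinuousOn (fun t => interactionEnergy p (u t) (n t)) (Icc 0 T) :=
    (intC (L := L)).continuous.comp_continuousOn
      (((hS.n_cont.fst.mul hρ).const_smul p.lam).add ((hρ.mul hρ).const_smul (p.g / 2)))
  have hlog := (intC (L := L)).continuous.comp_continuousOn
    ((ContinuousMap.continuous_postcomp (X := AddCircle L) (logC hδ)).comp_continuousOn
      hS.n_cont.fst)
  have hn := (intC (L := L)).continuous.comp_continuousOn hS.n_cont.fst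
  exact ((((continuousOn_const.mul (hS.u_cont.snd.norm.pow 2)).add hI).add
    (continuousOn_const.mul ((continuousOn_sqrtPair hδ hS.n_cont).snd.norm.pow 2))).sub
    (continuousOn_const.mul hlog)).add (continuousOn_const.mul hn)

lemma hasDerivAt_pairF (hn : ∀ t ∈ Icc 0 T, ∀ x, δ ≤ (n t).1 x) {t : ℝ} (ht : t ∈ Ioo 0 T) :
    HasDerivAt (fun s => pairF p ε hδ (u s) (n s)) (pairFRate p ε hδ (u t) (n t)) t := by
  have h1 := (hasDerivAt_kinetic hS ht).const_mul (1 / 2)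
  have h2 := hasDerivAt_interactionEnergy hS ht
  have h3 := ((hasDerivAt_sqrt_snd (hδ := hδ) hS hn ht).norm_sq).const_mul (ε / 2)
  have h4 := ((intC (L := L)).hasFDerivAt.comp_hasDerivAt t
    (hasDerivAt_log (hδ := hδ) hS hn ht)).const_mul (p.lam * p.P / p.R)
  have h5 := ((intC (L := L)).hasFDerivAt.comp_hasDerivAt t
    (hasDerivAt_n hS ht)).const_mul (p.β * p.lam / p.R)
  refine ((((h1.add h2).add h3).sub h4).add h5).congr_deriv ?_
  rw [pairFRate]
  ring

end

/-- The energy is controlled by `F`, because `n` is bounded above and so is `∫ ln n`. -/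
lemma energy_le_pairF (p : Params) {ε : ℝ} (hε : 0 < ε) {δ : ℝ} (hδ : 0 < δ) {M : ℝ}
    (u : Pair L ℂ) {n : Pair L ℝ} (hn : ∀ x, δ ≤ n.1 x) (hM : ∀ x, n.1 x ≤ M) :
    1 / 2 * ‖u.2‖ ^ 2 + interactionEnergy p u n ≤
      pairF p ε hδ u n + p.lam * p.P / p.R * (L * max (Real.log M) 0) := by
  have hR := p.R_pos
  have hlam := p.lam_pos
  have hP := p.P_pos
  have hβ := p.β_pos
  have h1 : intC ((logC hδ).comp n.1) ≤ L * max (Real.log M) 0 := by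
    have h2 : ∫ _ : AddCircle L, max (Real.log M) 0 = L * max (Real.log M) 0 := by
      rw [integral_const, Measure.real, AddCircle.measure_univ, ENNReal.toReal_ofReal hL.out.le,
        smul_eq_mul]
    rw [intC_apply, ← h2]
    refine integral_mono (integrable_continuous _) (integrable_const _) fun x => ?_
    change (logC hδ).comp n.1 x ≤ _
    rw [logC_comp hn]
    exact le_max_of_le_left (Real.log_le_log (hδ.trans_le (hn x)) (hM x))
  have h3 : 0 ≤ intC n.1 := by
    rw [intC_apply]
    exact integral_nonneg fun x => hδ.le.trans (hn x)
  have h4 : 0 ≤ ε / 2 * ‖(sqrtPair hδ n).2‖ ^ 2 := by positivity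
  have h5 : 0 ≤ p.β * p.lam / p.R * intC n.1 := by positivity
  have h6 : p.lam * p.P / p.R * intC ((logC hδ).comp n.1) ≤
      p.lam * p.P / p.R * (L * max (Real.log M) 0) :=
    mul_le_mul_of_nonneg_left h1 (by positivity)
  rw [pairF]
  linarith

/-! ### Identification with the functional `F` -/

/-- Uniqueness of the weak derivative. -/
lemma weakDeriv_ae_eq {q : Pair L ℝ} (hq : q ∈ sobolevPairs L ℝ) {f : AddCircle L → ℝ}
    (hf : f =ᵐ[volume] q.1) : weakDeriv f =ᵐ[volume] q.2 := by
  have hex : ∃ v : AddCircle L → ℝ, MemLp v 2 volume ∧ IsWeakDeriv f v :=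
    ⟨q.2, Lp.memLp q.2, isWeakDeriv_of_mem_sobolevPairs hq hf EventuallyEq.rfl⟩
  have hw : weakDeriv f = hex.choose := by rw [weakDeriv, dif_pos hex]
  obtain ⟨h1, h2⟩ := hex.choose_spec
  rw [← hw] at h1 h2
  set v : L2 L ℝ := h1.toLp (weakDeriv f)
  have hv : (v : AddCircle L → ℝ) =ᵐ[volume] weakDeriv f := h1.coeFn_toLp
  have h3 : v - q.2 = 0 := by
    refine eq_zero_of_forall_integral_smooth fun r hr => ?_
    obtain ⟨d, hr1, hr2, hr3⟩ := hr
    have h4 := h2 r.1 hr1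
    have h5 := isWeakDeriv_of_mem_sobolevPairs hq hf EventuallyEq.rfl r.1 hr1
    rw [h4, neg_inj] at h5
    have h6 : ∫ x, (v - q.2 : L2 L ℝ) x * r.1 x =
        ∫ x, (v x * r.1 x - q.2 x * r.1 x) := by
      refine integral_congr_ae ?_
      filter_upwards [Lp.coeFn_sub v q.2] with x hx
      rw [hx, Pi.sub_apply, sub_mul]
    rw [h6, integral_sub (integrable_mul_continuous _ _) (integrable_mul_continuous _ _), ← h5,
      sub_eq_zero]
    refine integral_congr_ae ?_
    filter_upwards [hv] with x hx
    rw [hx]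
  rw [← sub_eq_zero.1 h3]
  exact hv.symm

lemma integral_norm_sq_real (v : L2 L ℝ) : ‖v‖ ^ 2 = ∫ x, v x ^ 2 := by
  rw [← real_inner_self_eq_norm_sq, L2.inner_def]
  simp only [real_inner_self_eq_norm_sq, Real.norm_eq_abs, sq_abs]

lemma integrable_norm_sq (v : L2 L ℂ) : Integrable (fun x => 1 / 2 * ‖v x‖ ^ 2) volume := by
  have h := L2.integrable_inner (𝕜 := ℝ) v v
  simp only [real_inner_self_eq_norm_sq] at h
  exact h.const_mul _

section

variable {u : Pair L ℂ} {n : Pair L ℝ} {ψ : H1 L ℂ} {m : H1 L ℝ}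
  (hu1 : toL2 u.1 = ψ.1.1) (hu2 : u.2 = ψ.1.2) (hm1 : toL2 n.1 = m.1.1)

include hu1 in
lemma H1.fn_ae_complex : ψ.fn =ᵐ[volume] u.1 := by
  have h := coeFn_toL2 u.1
  rw [hu1] at h
  exact h

include hm1

lemma H1.fn_ae_real : m.fn =ᵐ[volume] n.1 := by
  have h := coeFn_toL2 n.1
  rw [hm1] at h
  exact h

/-- The continuous representative is unique, so positivity holds for the one at hand. -/
lemma H1.Pos.pos (h : m.Pos) (x : AddCircle L) : 0 < n.1 x := by
  obtain ⟨c, hc, hpos⟩ := h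
  have h1 : n.1 = c := by
    apply toL2_injective
    apply Lp.ext
    filter_upwards [coeFn_toL2 n.1, coeFn_toL2 c, H1.fn_ae_real hm1, hc] with x h1 h2 h3 h4
    rw [h1, h2, ← h3, h4]
  rw [h1]
  exact hpos x

include hu1 hu2

lemma energyDensity_ae (p : Params) : energyDensity p ψ m =ᵐ[volume] fun x =>
    1 / 2 * ‖u.2 x‖ ^ 2 + (p.lam • (n.1 * (density u).1) +
      (p.g / 2) • ((density u).1 * (density u).1)) x := by
  filter_upwards [H1.fn_ae_complex hu1, H1.fn_ae_real hm1] with x h1 h2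
  rw [energyDensity, h1, h2, H1.dx, ← hu2]
  change _ = _ + (p.lam * (n.1 x * (density u).1 x) +
    p.g / 2 * ((density u).1 x * (density u).1 x))
  rw [density_fst]
  ring

lemma energy_eq (p : Params) : energy p ψ m = 1 / 2 * ‖u.2‖ ^ 2 + interactionEnergy p u n := by
  rw [energy, integral_congr_ae (energyDensity_ae hu1 hu2 hm1 p),
    integral_add (integrable_norm_sq u.2) (integrable_continuous _), integral_const_mul,
    ← integral_norm_sq, interactionEnergy, intC_apply]

variable {δ : ℝ} (hδ : 0 < δ) (hmem : n ∈ sobolevPairs L ℝ) (hn : ∀ x, δ ≤ n.1 x)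
include hδ hmem hn

lemma finiteF (p : Params) : FiniteF p ψ m := by
  have hm := H1.fn_ae_real hm1
  have hsq : (fun y => √(m.fn y)) =ᵐ[volume] (sqrtPair hδ n).1 := by
    filter_upwards [hm] with x hx
    rw [hx]; rfl
  refine ⟨?_, ⟨?_, ?_⟩, ?_, ?_⟩
  · exact ((integrable_norm_sq u.2).add (integrable_continuous _)).congr
      (energyDensity_ae hu1 hu2 hm1 p).symm
  · exact (Lp.memLp (toL2 (sqrtPair hδ n).1)).ae_eq
      ((coeFn_toL2 (sqrtPair hδ n).1).trans hsq.symm)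
  · exact ⟨(sqrtPair hδ n).2, Lp.memLp _,
      isWeakDeriv_of_mem_sobolevPairs (sqrtPair_mem hn hmem) hsq EventuallyEq.rfl⟩
  · refine (integrable_continuous ((logC hδ).comp n.1)).congr ?_
    filter_upwards [hm] with x hx
    rw [hx, logC_comp hn]
  · exact (integrable_continuous n.1).congr hm.symm

lemma functionalF_eq (p : Params) (ε : ℝ) : functionalF p ε ψ m = pairF p ε hδ u n := by
  have hm := H1.fn_ae_real hm1
  have hsq : (fun y => √(m.fn y)) =ᵐ[volume] (sqrtPair hδ n).1 := by
    filter_upwards [hm] with x hx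
    rw [hx]; rfl
  have h1 : ∫ x, (weakDeriv (fun y => √(m.fn y)) x) ^ 2 = ‖(sqrtPair hδ n).2‖ ^ 2 := by
    rw [integral_norm_sq_real]
    refine integral_congr_ae ?_
    filter_upwards [weakDeriv_ae_eq (sqrtPair_mem (hδ := hδ) hn hmem) hsq] with x hx
    rw [hx]
  have h2 : ∫ x, Real.log (m.fn x) = intC ((logC hδ).comp n.1) := by
    rw [intC_apply]
    refine integral_congr_ae ?_
    filter_upwards [hm] with x hx
    rw [hx, logC_comp hn]
  rw [functionalF, energy_eq hu1 hu2 hm1, h1, h2, integral_congr_ae hm, ← intC_apply, pairF]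

end

end GrossPitaevskii

end

theorem proposition2p4 (L : ℝ) [Fact (0 < L)] (p : GrossPitaevskii.Params) (N : ℝ) :
    ∃ C₁ C₂ : ℝ, 0 < C₁ ∧ 0 ≤ C₂ ∧
      ∀ ε : ℝ, 0 < ε → ε ≤ 1 → ∀ T : EReal, 0 < T →
      ∀ (ψ : ℝ → GrossPitaevskii.H1 L ℂ) (n : ℝ → GrossPitaevskii.H1 L ℝ),
        GrossPitaevskii.IsSolution p ε T ψ n →
        (∀ t ∈ GrossPitaevskii.timeInterval T, GrossPitaevskii.H1.Pos (n t)) →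
        (∀ᵐ x, GrossPitaevskii.H1.fn (n 0) x ≤ N) →
        ∀ t ∈ GrossPitaevskii.timeInterval T,
          GrossPitaevskii.FiniteF p (ψ t) (n t) ∧
          GrossPitaevskii.functionalF p ε (ψ t) (n t) ≤
            Real.exp (C₁ * t) * (GrossPitaevskii.functionalF p ε (ψ 0) (n 0) + C₂ / C₁)
              - C₂ / C₁ := by
  open GrossPitaevskii in
  have hP := p.P_pos
  have hβ := p.β_pos
  have hR := p.R_pos
  have hlam := p.lam_pos
  have hL0 : 0 < L := Fact.out
  set M := max N (p.P / p.β)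
  have hM0 : 0 < M := lt_max_of_lt_right (by positivity)
  set c := p.lam * p.P / p.R * (L * max (Real.log M) 0)
  have hc0 : 0 ≤ c := by
    have : 0 ≤ max (Real.log M) 0 := le_max_right _ _
    positivity
  set C := 2 * p.R * M
  have hC : 0 < C := by positivity
  refine ⟨C, C * c, hC, by positivity, ?_⟩
  intro ε hε _ T _ ψ n hsol hpos hN t ht
  rw [mul_div_cancel_left₀ _ hC.ne']
  obtain ⟨u, m, hS, hu, hm⟩ := hsol.exists_isPairSolution hε ht
  have hsub : ∀ s ∈ Icc 0 t, s ∈ timeInterval T := fun s hs =>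
    ⟨hs.1, lt_of_le_of_lt (by exact_mod_cast hs.2) ht.2⟩
  have hmpos : ∀ s ∈ Icc 0 t, ∀ x, 0 < (m s).1 x := fun s hs =>
    (hpos s (hsub s hs)).pos (hm s).1
  obtain ⟨δ, hδ, hmδ⟩ := exists_lower_bound hS ht.1 hmpos
  have h0 : ∀ x, (m 0).1 x ≤ M := by
    -- an almost everywhere inequality between continuous functions holds everywhere
    have h1 : (fun x => max ((m 0).1 x) N) =ᵐ[MeasureTheory.volume] fun _ => N := by
      filter_upwards [H1.fn_ae_real (hm 0).1, hN] with x h2 h3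
      rw [← h2, max_eq_right h3]
    have h2 := (Continuous.ae_eq_iff_eq MeasureTheory.volume (by fun_prop) (by fun_prop)).1 h1
    intro x
    exact (le_max_left _ _).trans ((congrFun h2 x).le.trans (le_max_left _ _))
  have hmM : ∀ s ∈ Icc 0 t, ∀ x, (m s).1 x ≤ M := fun s hs x =>
    n_le hS hε hmpos (le_max_right _ _) h0 hs x
  have ht0 : (0 : ℝ) ∈ Icc 0 t := left_mem_Icc.2 ht.1
  have htt : t ∈ Icc 0 t := right_mem_Icc.2 ht.1
  refine ⟨finiteF (hu t).1 (hu t).2 (hm t).1 hδ (hS.n_mem t) (hmδ t htt) p, ?_⟩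
  rw [functionalF_eq (hu t).1 (hu t).2 (hm t).1 hδ (hS.n_mem t) (hmδ t htt) p,
    functionalF_eq (hu 0).1 (hu 0).2 (hm 0).1 hδ (hS.n_mem 0) (hmδ 0 ht0) p]
  have h1 := le_exp_mul_of_hasDerivAt_le (y := fun s => pairF p ε hδ (u s) (m s) + c) (C := C)
    (continuousOn_pairF hS |>.add continuousOn_const)
    (fun s hs => (hasDerivAt_pairF hS hmδ hs).add_const c) (fun s hs => ?_) htt
  · linarith
  · have hs' := Ioo_subset_Icc_self hs
    exact (pairFRate_le p hε hδ (u s) (hmδ s hs') (hmM s hs')).trans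
      (mul_le_mul_of_nonneg_left (energy_le_pairF p hε hδ (u s) (hmδ s hs') (hmM s hs')) hC.le)
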